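/- Let $\Phi$ be a commutative ring and let $A$ be a semiprime associative (not necessarily unital) $\Phi$-algebra, i.e. $I^2\neq 0$ for every nonzero ideal $I$ of $A$. Suppose that $A=\bigoplus_{k=-n}^{n}A_k$ ($n\ge 0$) is $\mathbb Z$-graded with $A_k=0$ for $|k|>n$, that $A$ is right faithful ($Ax=0$ implies $x=0$), that $A$ is generated as an ideal by $A_{-n}$, and that $A=A_0AA_0$. (For subspaces, a product such as $A_0AA_0$ is the span of all products of elements.) For a semiprime algebra $B$, let $Q_s(B)$ be the Martindale symmetric algebra of quotients of $B$: its elements are the classes of pairs $(f,g)$, where $f\colon I\to B$ is a left and $g\colon I\to B$ a right $B$-module homomorphism on an essential ideal $I$ of $B$ (an ideal that meets every nonzero ideal nontrivially) with $((x)f)\,y=x\,g(y)$ for all $x,y\in I$; two pairs are identified if they agree on some essential ideal, and $B$ is embedded in $Q_s(B)$ by right and left multiplications. Put $H_i=A_iA_{-n}A_{n-i}$ for $0\le i\le n$. Then $A_0$ is semiprime, and there is a complete system of orthogonal idempotents $e_0,\dots,e_n\in Q_s(A)$ inducing the grading of $A$, that is, $H_iAH_j=e_iAe_j$ for all $0\le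 i,j\le n$. For every such system, the submodules $$Q_s(A)_k=\sum_{i-j=k}e_i\,Q_s(A)\,e_j\qquad(k\in\mathbb Z)$$ form a $\mathbb Z$-grading of $Q_s(A)$ with $A_k\subseteq Q_s(A)_k$ for all $k$, and for this induced grading $$Q_s(A)_0\;\cong\;Q_s(A_0)$$ as $\Phi$-algebras, by an isomorphism that is the identity on $A_0$. -/

import Mathlib

set_option linter.unusedSectionVars false

namespace Martindale

universe u v

section Ideals

variable {Φ : Type v} {A : Type u} [CommRing Φ] [NonUnitalRing A] [Module Φ A]
  [IsScalarTower Φ A A] [SMulCommClass Φ A A]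

/-- Two-sided ideals of a (not necessarily unital) associative `Φ`-algebra. -/
def IsIdeal (I : Submodule Φ A) : Prop :=
  ∀ a : A, ∀ x ∈ I, a * x ∈ I ∧ x * a ∈ I

/-- The ideal `id(X)` of the algebra generated by a subset `X`. -/
def idealSpan (X : Set A) : Submodule Φ A :=
  sInf {I : Submodule Φ A | IsIdeal I ∧ X ⊆ I}

/-- The product `MN` of two submodules: the span of all products `m * n`. -/
def prod (M N : Submodule Φ A) : Submodule Φ A :=
  Submodule.map₂ (LinearMap.mul Φ A) M N

/-- An ideal whose intersection with every nonzero ideal is nonzero. -/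
structure IsEssentialIdeal (I : Submodule Φ A) : Prop where
  isIdeal : IsIdeal I
  inf_ne_bot : ∀ L : Submodule Φ A, IsIdeal L → L ≠ ⊥ → I ⊓ L ≠ ⊥

variable (Φ A) in
/-- Semiprime algebras: `I² ≠ 0` for every nonzero ideal `I`. -/
class IsSemiprime : Prop where
  prod_self_ne_bot : ∀ I : Submodule Φ A, IsIdeal I → I ≠ ⊥ → prod I I ≠ ⊥

theorem mul_mem_prod {M N : Submodule Φ A} {x y : A} (hx : x ∈ M) (hy : y ∈ N) :
    x * y ∈ prod M N :=
  Submodule.apply_mem_map₂ (LinearMap.mul Φ A) hx hy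

theorem prod_le {M N P : Submodule Φ A} :
    prod M N ≤ P ↔ ∀ x ∈ M, ∀ y ∈ N, x * y ∈ P := by
  simp [prod, Submodule.map₂_le]

theorem IsIdeal.inf {I J : Submodule Φ A} (hI : IsIdeal I) (hJ : IsIdeal J) :
    IsIdeal (I ⊓ J) :=
  fun a x hx => ⟨⟨(hI a x hx.1).1, (hJ a x hx.2).1⟩, ⟨(hI a x hx.1).2, (hJ a x hx.2).2⟩⟩

theorem IsIdeal.prod {I J : Submodule Φ A} (hI : IsIdeal I) (hJ : IsIdeal J) :
    IsIdeal (prod I J) := by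
  intro a x hx
  constructor
  · have h : Martindale.prod I J ≤ (Martindale.prod I J).comap (LinearMap.mulLeft Φ a) := by
      rw [prod_le]
      intro x hx y hy
      simp only [Submodule.mem_comap, LinearMap.mulLeft_apply, ← mul_assoc]
      exact mul_mem_prod (hI a x hx).1 hy
    exact h hx
  · have h : Martindale.prod I J ≤ (Martindale.prod I J).comap (LinearMap.mulRight Φ a) := by
      rw [prod_le]
      intro x hx y hy
      simp only [Submodule.mem_comap, LinearMap.mulRight_apply, mul_assoc]
      exact mul_mem_prod hx (hJ a y hy).2
    exact h hx

theorem prod_le_left {I J : Submodule Φ A} (hI : IsIdeal I) : prod I J ≤ I :=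
  prod_le.2 fun x hx y _ => (hI y x hx).2

theorem prod_le_right {I J : Submodule Φ A} (hJ : IsIdeal J) : prod I J ≤ J :=
  prod_le.2 fun x _ y hy => (hJ x y hy).1

theorem prod_mono {I J I' J' : Submodule Φ A} (h : I ≤ I') (h' : J ≤ J') :
    prod I J ≤ prod I' J' :=
  Submodule.map₂_le_map₂ h h'

theorem IsEssentialIdeal.top : IsEssentialIdeal (⊤ : Submodule Φ A) :=
  ⟨fun _ _ _ => ⟨trivial, trivial⟩, fun L _ h => by simpa using h⟩

theorem IsEssentialIdeal.inf {I J : Submodule Φ A} (hI : IsEssentialIdeal I)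
    (hJ : IsEssentialIdeal J) : IsEssentialIdeal (I ⊓ J) :=
  ⟨hI.isIdeal.inf hJ.isIdeal, fun L hL h => by
    rw [inf_assoc]
    exact hI.inf_ne_bot _ (hJ.isIdeal.inf hL) (hJ.inf_ne_bot L hL h)⟩

theorem IsEssentialIdeal.prod [IsSemiprime Φ A] {I J : Submodule Φ A}
    (hI : IsEssentialIdeal I) (hJ : IsEssentialIdeal J) : IsEssentialIdeal (prod I J) := by
  refine ⟨hI.isIdeal.prod hJ.isIdeal, fun L hL h h0 => ?_⟩
  have hid := (hI.inf hJ).isIdeal.inf hL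
  refine IsSemiprime.prod_self_ne_bot _ hid ((hI.inf hJ).inf_ne_bot L hL h) ?_
  rw [eq_bot_iff, ← h0]
  exact le_inf (prod_mono (inf_le_left.trans inf_le_left) (inf_le_left.trans inf_le_right))
    ((prod_le_left hid).trans inf_le_right)

end Ideals

section Quotients

variable (Φ : Type v) (A : Type u) [CommRing Φ] [NonUnitalRing A] [Module Φ A]
  [IsScalarTower Φ A A] [SMulCommClass Φ A A]

/-- A compatible pair on an essential ideal `I`: a left `A`-homomorphism `f : I → A` and a right
`A`-homomorphism `g : I → A` such that `((x)f) y = x g(y)`.  (Two maps with different essential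
domains are first restricted to the intersection of these.) -/
structure CompatiblePair where
  dom : Submodule Φ A
  essential : IsEssentialIdeal dom
  f : dom →ₗ[Φ] A
  g : dom →ₗ[Φ] A
  f_mul : ∀ (a x : A) (hx : x ∈ dom), f ⟨a * x, (essential.isIdeal a x hx).1⟩ = a * f ⟨x, hx⟩
  g_mul : ∀ (a x : A) (hx : x ∈ dom), g ⟨x * a, (essential.isIdeal a x hx).2⟩ = g ⟨x, hx⟩ * a
  compat : ∀ x y : dom, f x * (y : A) = (x : A) * g y

variable {Φ A}

namespace CompatiblePair

/-- Two compatible pairs are identified when they agree on some essential ideal. -/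
def Rel (p q : CompatiblePair Φ A) : Prop :=
  ∃ (K : Submodule Φ A) (_ : IsEssentialIdeal K) (hp : K ≤ p.dom) (hq : K ≤ q.dom),
    ∀ (x : A) (hx : x ∈ K), p.f ⟨x, hp hx⟩ = q.f ⟨x, hq hx⟩ ∧ p.g ⟨x, hp hx⟩ = q.g ⟨x, hq hx⟩

theorem Rel.refl (p : CompatiblePair Φ A) : Rel p p :=
  ⟨p.dom, p.essential, le_rfl, le_rfl, fun _ _ => ⟨rfl, rfl⟩⟩

theorem Rel.symm {p q : CompatiblePair Φ A} : Rel p q → Rel q p :=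
  fun ⟨K, hK, hp, hq, h⟩ => ⟨K, hK, hq, hp, fun x hx => ⟨(h x hx).1.symm, (h x hx).2.symm⟩⟩

theorem Rel.trans {p q r : CompatiblePair Φ A} : Rel p q → Rel q r → Rel p r :=
  fun ⟨K, hK, hp, _, h⟩ ⟨L, hL, _, hr, h'⟩ =>
    ⟨K ⊓ L, hK.inf hL, inf_le_left.trans hp, inf_le_right.trans hr, fun x hx =>
      ⟨(h x hx.1).1.trans (h' x hx.2).1, (h x hx.1).2.trans (h' x hx.2).2⟩⟩

instance setoid : Setoid (CompatiblePair Φ A) :=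
  ⟨Rel, Rel.refl, Rel.symm, Rel.trans⟩

/-- The pair of right and left multiplications by an element of `A`. -/
def ofElem (a : A) : CompatiblePair Φ A where
  dom := ⊤
  essential := IsEssentialIdeal.top
  f := (LinearMap.mulRight Φ a).comp (Submodule.subtype ⊤)
  g := (LinearMap.mulLeft Φ a).comp (Submodule.subtype ⊤)
  f_mul b x _ := by simp [mul_assoc]
  g_mul b x _ := by simp [mul_assoc]
  compat x y := by simp [mul_assoc]

protected def one : CompatiblePair Φ A where
  dom := ⊤
  essential := IsEssentialIdeal.top
  f := Submodule.subtype ⊤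
  g := Submodule.subtype ⊤
  f_mul _ _ _ := rfl
  g_mul _ _ _ := rfl
  compat _ _ := rfl

protected def add (p q : CompatiblePair Φ A) : CompatiblePair Φ A where
  dom := p.dom ⊓ q.dom
  essential := p.essential.inf q.essential
  f := p.f.comp (Submodule.inclusion inf_le_left) + q.f.comp (Submodule.inclusion inf_le_right)
  g := p.g.comp (Submodule.inclusion inf_le_left) + q.g.comp (Submodule.inclusion inf_le_right)
  f_mul a x hx :=
    (congrArg₂ (· + ·) (p.f_mul a x hx.1) (q.f_mul a x hx.2)).trans (mul_add _ _ _).symm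
  g_mul a x hx :=
    (congrArg₂ (· + ·) (p.g_mul a x hx.1) (q.g_mul a x hx.2)).trans (add_mul _ _ _).symm
  compat x y := (add_mul _ _ _).trans <|
    (congrArg₂ (· + ·) (p.compat ⟨x, x.2.1⟩ ⟨y, y.2.1⟩) (q.compat ⟨x, x.2.2⟩ ⟨y, y.2.2⟩)).trans
      (mul_add _ _ _).symm

protected def smul (c : Φ) (p : CompatiblePair Φ A) : CompatiblePair Φ A where
  dom := p.dom
  essential := p.essential
  f := c • p.f
  g := c • p.g
  f_mul a x hx := by
    simp only [LinearMap.smul_apply, p.f_mul a x hx, mul_smul_comm]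
  g_mul a x hx := by
    simp only [LinearMap.smul_apply, p.g_mul a x hx, smul_mul_assoc]
  compat x y := by
    simp only [LinearMap.smul_apply, smul_mul_assoc, mul_smul_comm, p.compat x y]

theorem f_mem (p : CompatiblePair Φ A) {J : Submodule Φ A} (hJ : IsIdeal J) (x : A)
    (hx : x ∈ prod J p.dom) : p.f ⟨x, prod_le_right p.essential.isIdeal hx⟩ ∈ J := by
  have h : prod J p.dom ≤ (J.comap p.f).map p.dom.subtype := by
    rw [prod_le]
    intro a ha y hy
    refine ⟨⟨a * y, (p.essential.isIdeal a y hy).1⟩, ?_, rfl⟩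
    simp only [SetLike.mem_coe, Submodule.mem_comap, p.f_mul a y hy]
    exact (hJ _ a ha).2
  obtain ⟨z, hz, rfl⟩ := h hx
  exact hz

theorem g_mem (p : CompatiblePair Φ A) {J : Submodule Φ A} (hJ : IsIdeal J) (x : A)
    (hx : x ∈ prod p.dom J) : p.g ⟨x, prod_le_left p.essential.isIdeal hx⟩ ∈ J := by
  have h : prod p.dom J ≤ (J.comap p.g).map p.dom.subtype := by
    rw [prod_le]
    intro y hy a ha
    refine ⟨⟨y * a, (p.essential.isIdeal a y hy).2⟩, ?_, rfl⟩
    simp only [SetLike.mem_coe, Submodule.mem_comap, p.g_mul a y hy]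
    exact (hJ _ a ha).1
  obtain ⟨z, hz, rfl⟩ := h hx
  exact hz

/-- The product `pq`: `(x)(pq) = ((x)p)q` for the left homomorphisms, `(pq)(y) = p(q(y))` for the
right ones, on the essential ideal `dom q * dom p`, on which both composites are defined. -/
protected def mul [IsSemiprime Φ A] (p q : CompatiblePair Φ A) : CompatiblePair Φ A where
  dom := prod q.dom p.dom
  essential := q.essential.prod p.essential
  f := q.f.comp ((p.f.comp (Submodule.inclusion (prod_le_right p.essential.isIdeal))).codRestrict
    q.dom fun x => p.f_mem q.essential.isIdeal x x.2)
  g := p.g.comp ((q.g.comp (Submodule.inclusion (prod_le_left q.essential.isIdeal))).codRestrict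
    p.dom fun x => q.g_mem p.essential.isIdeal x x.2)
  f_mul a x hx := by
    have h := p.f_mul a x (prod_le_right p.essential.isIdeal hx)
    refine Eq.trans ?_ (q.f_mul a _ (p.f_mem q.essential.isIdeal x hx))
    exact congrArg q.f (Subtype.ext h)
  g_mul a x hx := by
    have h := q.g_mul a x (prod_le_left q.essential.isIdeal hx)
    refine Eq.trans ?_ (p.g_mul a _ (q.g_mem p.essential.isIdeal x hx))
    exact congrArg p.g (Subtype.ext h)
  compat x y :=
    (q.compat ⟨_, p.f_mem q.essential.isIdeal x x.2⟩
      ⟨y, prod_le_left q.essential.isIdeal y.2⟩).trans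
      (p.compat ⟨x, prod_le_right p.essential.isIdeal x.2⟩
        ⟨_, q.g_mem p.essential.isIdeal y y.2⟩)

theorem add_rel {p p' q q' : CompatiblePair Φ A} :
    Rel p p' → Rel q q' → Rel (p.add q) (p'.add q') :=
  fun ⟨K, hK, hp, hp', h⟩ ⟨L, hL, hq, hq', h'⟩ =>
    ⟨K ⊓ L, hK.inf hL, inf_le_inf hp hq, inf_le_inf hp' hq', fun x hx =>
      ⟨congrArg₂ (· + ·) (h x hx.1).1 (h' x hx.2).1,
        congrArg₂ (· + ·) (h x hx.1).2 (h' x hx.2).2⟩⟩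

theorem smul_rel (c : Φ) {p p' : CompatiblePair Φ A} :
    Rel p p' → Rel (p.smul c) (p'.smul c) :=
  fun ⟨K, hK, hp, hp', h⟩ => ⟨K, hK, hp, hp', fun x hx =>
    ⟨congrArg (c • ·) (h x hx).1, congrArg (c • ·) (h x hx).2⟩⟩

/-- Restriction of a compatible pair to a smaller essential ideal. -/
protected def restrict (p : CompatiblePair Φ A) (K : Submodule Φ A) (hK : IsEssentialIdeal K)
    (h : K ≤ p.dom) : CompatiblePair Φ A where
  dom := K
  essential := hK
  f := p.f.comp (Submodule.inclusion h)
  g := p.g.comp (Submodule.inclusion h)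
  f_mul a x hx := p.f_mul a x (h hx)
  g_mul a x hx := p.g_mul a x (h hx)
  compat x y := p.compat ⟨x, h x.2⟩ ⟨y, h y.2⟩

theorem mul_rel [IsSemiprime Φ A] {p p' q q' : CompatiblePair Φ A} :
    Rel p p' → Rel q q' → Rel (p.mul q) (p'.mul q') := by
  rintro ⟨K, hK, hp, hp', h⟩ ⟨L, hL, hq, hq', h'⟩
  refine ⟨prod L K, hL.prod hK, prod_mono hq hp, prod_mono hq' hp', fun x hx => ⟨?_, ?_⟩⟩
  · have hxK := prod_le_right hK.isIdeal hx
    have hm : p.f ⟨x, hp hxK⟩ ∈ L := (p.restrict K hK hp).f_mem hL.isIdeal x hx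
    refine (h' _ hm).1.trans (congrArg q'.f (Subtype.ext ?_))
    exact (h x hxK).1
  · have hxL := prod_le_left hL.isIdeal hx
    have hm : q.g ⟨x, hq hxL⟩ ∈ K := (q.restrict L hL hq).g_mem hK.isIdeal x hx
    refine (h _ hm).2.trans (congrArg p'.g (Subtype.ext ?_))
    exact (h' x hxL).2

/-- Pairs that agree wherever both are defined are identified. -/
theorem rel_of {p q : CompatiblePair Φ A}
    (hf : ∀ (x : A) (hp : x ∈ p.dom) (hq : x ∈ q.dom), p.f ⟨x, hp⟩ = q.f ⟨x, hq⟩)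
    (hg : ∀ (x : A) (hp : x ∈ p.dom) (hq : x ∈ q.dom), p.g ⟨x, hp⟩ = q.g ⟨x, hq⟩) :
    Rel p q :=
  ⟨p.dom ⊓ q.dom, p.essential.inf q.essential, inf_le_left, inf_le_right,
    fun x hx => ⟨hf x hx.1 hx.2, hg x hx.1 hx.2⟩⟩

end CompatiblePair

variable (Φ A) in
/-- The Martindale symmetric algebra of quotients `Q_s(A)` of a semiprime algebra `A`: compatible
pairs of homomorphisms defined on essential ideals, modulo agreement on an essential ideal. -/
def Qs [IsSemiprime Φ A] : Type u :=
  Quotient (CompatiblePair.setoid (Φ := Φ) (A := A))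

namespace Qs

variable [IsSemiprime Φ A]

open CompatiblePair

def mk (p : CompatiblePair Φ A) : Qs Φ A := Quotient.mk _ p

theorem sound {p q : CompatiblePair Φ A} (h : Rel p q) : mk p = mk q := Quotient.sound h

instance : Zero (Qs Φ A) := ⟨mk (ofElem 0)⟩
instance : One (Qs Φ A) := ⟨mk CompatiblePair.one⟩
instance : Add (Qs Φ A) :=
  ⟨Quotient.map₂ CompatiblePair.add fun _ _ h _ _ h' => add_rel h h'⟩
instance : Mul (Qs Φ A) :=
  ⟨Quotient.map₂ CompatiblePair.mul fun _ _ h _ _ h' => mul_rel h h'⟩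
instance : SMul Φ (Qs Φ A) :=
  ⟨fun c => Quotient.map (CompatiblePair.smul c) fun _ _ h => smul_rel c h⟩
instance : Neg (Qs Φ A) := ⟨fun q => (-1 : Φ) • q⟩

instance : AddCommGroup (Qs Φ A) where
  add_assoc := by
    rintro ⟨p⟩ ⟨q⟩ ⟨r⟩
    exact sound (rel_of (fun _ _ _ => add_assoc _ _ _) (fun _ _ _ => add_assoc _ _ _))
  add_comm := by
    rintro ⟨p⟩ ⟨q⟩
    exact sound (rel_of (fun _ _ _ => add_comm _ _) (fun _ _ _ => add_comm _ _))
  zero_add := by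
    rintro ⟨p⟩
    refine sound (rel_of (fun x _ hq => ?_) (fun x _ hq => ?_))
    · change x * 0 + p.f ⟨x, hq⟩ = p.f ⟨x, hq⟩
      simp
    · change 0 * x + p.g ⟨x, hq⟩ = p.g ⟨x, hq⟩
      simp
  add_zero := by
    rintro ⟨p⟩
    refine sound (rel_of (fun x _ hq => ?_) (fun x _ hq => ?_))
    · change p.f ⟨x, hq⟩ + x * 0 = p.f ⟨x, hq⟩
      simp
    · change p.g ⟨x, hq⟩ + 0 * x = p.g ⟨x, hq⟩
      simp
  neg_add_cancel := by
    rintro ⟨p⟩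
    refine sound (rel_of (fun x hp _ => ?_) (fun x hp _ => ?_))
    · change (-1 : Φ) • p.f ⟨x, hp.2⟩ + p.f ⟨x, hp.2⟩ = x * 0
      simp
    · change (-1 : Φ) • p.g ⟨x, hp.2⟩ + p.g ⟨x, hp.2⟩ = 0 * x
      simp
  nsmul := nsmulRec
  zsmul := zsmulRec

instance : Module Φ (Qs Φ A) where
  one_smul := by
    rintro ⟨p⟩
    exact sound (rel_of (fun _ _ _ => one_smul _ _) (fun _ _ _ => one_smul _ _))
  mul_smul := by
    rintro c d ⟨p⟩
    exact sound (rel_of (fun _ _ _ => mul_smul _ _ _) (fun _ _ _ => mul_smul _ _ _))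
  smul_zero c := by
    refine sound (rel_of (fun x _ _ => ?_) (fun x _ _ => ?_))
    · change c • (x * 0) = x * 0
      simp
    · change c • (0 * x) = 0 * x
      simp
  smul_add := by
    rintro c ⟨p⟩ ⟨q⟩
    exact sound (rel_of (fun _ _ _ => smul_add _ _ _) (fun _ _ _ => smul_add _ _ _))
  add_smul := by
    rintro c d ⟨p⟩
    exact sound (rel_of (fun _ _ _ => add_smul _ _ _) (fun _ _ _ => add_smul _ _ _))
  zero_smul := by
    rintro ⟨p⟩
    refine sound (rel_of (fun x hp _ => ?_) (fun x hp _ => ?_))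
    · change (0 : Φ) • p.f ⟨x, hp⟩ = x * 0
      simp
    · change (0 : Φ) • p.g ⟨x, hp⟩ = 0 * x
      simp

instance : Ring (Qs Φ A) where
  __ := (inferInstance : AddCommGroup (Qs Φ A))
  mul_assoc := by
    rintro ⟨p⟩ ⟨q⟩ ⟨r⟩
    exact sound (rel_of (fun _ _ _ => rfl) (fun _ _ _ => rfl))
  one_mul := by
    rintro ⟨p⟩
    exact sound (rel_of (fun _ _ _ => rfl) (fun _ _ _ => rfl))
  mul_one := by
    rintro ⟨p⟩
    exact sound (rel_of (fun _ _ _ => rfl) (fun _ _ _ => rfl))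
  left_distrib := by
    rintro ⟨p⟩ ⟨q⟩ ⟨r⟩
    exact sound (rel_of (fun _ _ _ => rfl) (fun x h h' =>
      p.g.map_add ⟨_, q.g_mem p.essential.isIdeal x h'.1⟩
        ⟨_, r.g_mem p.essential.isIdeal x h'.2⟩))
  right_distrib := by
    rintro ⟨p⟩ ⟨q⟩ ⟨r⟩
    exact sound (rel_of (fun x h h' =>
      r.f.map_add ⟨_, p.f_mem r.essential.isIdeal x h'.1⟩
        ⟨_, q.f_mem r.essential.isIdeal x h'.2⟩) (fun _ _ _ => rfl))
  zero_mul := by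
    rintro ⟨p⟩
    refine sound (rel_of (fun x h _ => ?_) (fun x h _ => ?_))
    · refine Eq.trans (congrArg p.f (a₂ := 0) (Subtype.ext ?_)) ?_
      · exact mul_zero x
      · exact p.f.map_zero.trans (mul_zero x).symm
    · change 0 * p.g ⟨x, _⟩ = 0 * x
      simp
  mul_zero := by
    rintro ⟨p⟩
    refine sound (rel_of (fun x h _ => ?_) (fun x h _ => ?_))
    · change p.f ⟨x, _⟩ * 0 = x * 0
      simp
    · refine Eq.trans (congrArg p.g (a₂ := 0) (Subtype.ext ?_)) ?_
      · exact zero_mul x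
      · exact p.g.map_zero.trans (zero_mul x).symm

instance : Algebra Φ (Qs Φ A) :=
  Algebra.ofModule
    (by
      rintro c ⟨p⟩ ⟨q⟩
      exact sound (rel_of
        (fun x h _ => q.f.map_smul c ⟨_, p.f_mem q.essential.isIdeal x h⟩)
        (fun _ _ _ => rfl)))
    (by
      rintro c ⟨p⟩ ⟨q⟩
      exact sound (rel_of (fun _ _ _ => rfl)
        (fun x h _ => p.g.map_smul c ⟨_, q.g_mem p.essential.isIdeal x h⟩)))

variable (Φ A) in
/-- The canonical map `A → Q_s(A)`. -/
def of : A →ₙₐ[Φ] Qs Φ A where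
  toFun a := mk (ofElem a)
  map_smul' c a := sound (rel_of (fun x _ _ => mul_smul_comm c x a)
    (fun x _ _ => smul_mul_assoc c a x))
  map_zero' := rfl
  map_add' a b := sound (rel_of (fun x _ _ => mul_add x a b) (fun x _ _ => add_mul a b x))
  map_mul' a b := sound (rel_of (fun x _ _ => (mul_assoc x a b).symm)
    (fun x _ _ => mul_assoc a b x))

end Qs

end Quotients

section Gradings

variable {Φ : Type v} {A : Type u} [CommRing Φ] [NonUnitalRing A] [Module Φ A]
  [IsScalarTower Φ A A] [SMulCommClass Φ A A]

/-- The zero component `A_0` of a graded algebra, as an algebra. -/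
def zeroComponent (𝒜 : ℤ → Submodule Φ A) [SetLike.GradedMul 𝒜] : NonUnitalSubalgebra Φ A where
  __ := 𝒜 0
  mul_mem' ha hb := SetLike.mul_mem_graded (A := 𝒜) ha hb

/-- `H_i = A_i A_{-n} A_{n-i}`. -/
def peirceH (n : ℕ) (𝒜 : ℤ → Submodule Φ A) (i : Fin (n + 1)) : Submodule Φ A :=
  prod (prod (𝒜 (i : ℕ)) (𝒜 (-n))) (𝒜 (n - (i : ℕ)))

/-- `H_{ij} = H_i A H_j`. -/
def peirceHH (n : ℕ) (𝒜 : ℤ → Submodule Φ A) (i j : Fin (n + 1)) : Submodule Φ A :=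
  prod (prod (peirceH n 𝒜 i) ⊤) (peirceH n 𝒜 j)

/-- The map `q ↦ a q b`. -/
def sandwich {Q : Type*} [Ring Q] [Algebra Φ Q] (a b : Q) : Q →ₗ[Φ] Q :=
  (LinearMap.mulLeft Φ a).comp (LinearMap.mulRight Φ b)

/-- The grading of `A = ⨁_{k=-n}^n A_k` is induced by the family `e_0, …, e_n` of elements of
`Q_s(A)`: `H_{ij} = e_i A e_j` for all `i, j`. -/
def InducesGrading [IsSemiprime Φ A] (n : ℕ) (𝒜 : ℤ → Submodule Φ A)
    (e : Fin (n + 1) → Qs Φ A) : Prop :=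
  ∀ i j, (peirceHH n 𝒜 i j).map (Qs.of Φ A : A →ₗ[Φ] Qs Φ A) =
    (LinearMap.range (Qs.of Φ A : A →ₗ[Φ] Qs Φ A)).map (sandwich (e i) (e j))

/-- The components `Q_k = ∑_{i - j = k} e_i Q e_j` determined by `e_0, …, e_n ∈ Q`. -/
def idempotentGrading {Q : Type*} [Ring Q] [Algebra Φ Q] {n : ℕ} (e : Fin (n + 1) → Q) (k : ℤ) :
    Submodule Φ Q :=
  ⨆ (i : Fin (n + 1)) (j : Fin (n + 1)) (_ : ((i : ℕ) : ℤ) - ((j : ℕ) : ℤ) = k),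
    LinearMap.range (sandwich (Φ := Φ) (e i) (e j))

end Gradings

end Martindale

set_option linter.unusedSectionVars false

/-! The submodules `H_i = A_i A_{-n} A_{n-i}` are ideals of `A_0`. For `i ≠ j`, a product from `H_i
H_j` contains a factor of degree beyond `±n`, so `H_i H_j = 0`; in the same way `H_i A_k H_j = 0`
unless `i - j = k`. Since `A = A A_{-n} A`, projection to degree `0` shows that `A_0` is the sum of
the `H_i`. Thus `A` looks like a matrix algebra with diagonal `A_0 = ⨁ H_i`. `PeirceSystem` records
exactly what is used of this, and most of the argument never mentions the grading again.

The idempotent `e_i` is the pair of maps `a h ↦ δ_ij a h`, `h a ↦ δ_ij h a` for `h ∈ H_j`. These are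
defined on all of `A` because `A = A A_0 = A_0 A` (`exists_isUnitFamily`). Conversely, `H_j ⊆ H_j A
H_j` forces every system inducing the grading to act on the `H_j` in this way (`isUnitFamily`).

The component `Q_s(A)_0` consists of the `s` with `s = ∑ e_i s e_i`. It is identified with
`Q_s(A_0)` by a characterization of the quotient algebra (`IsSymmetricQuotient`, `exists_algEquiv`).
Two transfers of essential ideals verify it. An essential ideal of `A` meets `A_0` in an essential
ideal (`isEssentialIdeal_comap`). If `I` is essential in `A_0`, then `A I` and `I A` contain
essential ideals of `A` (`exists_essential_le_left`, `exists_essential_le_right`), so that a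
compatible pair of `A_0` extends to one of `A` (`exists_extension`). Both transfers move a nonzero
element into a corner `k A k` with `k ∈ H_i`, which lies in `A_0`. -/

namespace Martindale

universe u v

/-! ### Semiprimeness in terms of elements; annihilators of essential ideals -/

section Semiprime

variable {Φ : Type v} {A : Type u} [CommRing Φ] [NonUnitalRing A] [Module Φ A]
  [IsScalarTower Φ A A] [SMulCommClass Φ A A]

theorem IsIdeal.top : IsIdeal (⊤ : Submodule Φ A) := fun _ _ _ => ⟨trivial, trivial⟩

/-- The left annihilator of `I`. -/
def leftAnn (I : Submodule Φ A) : Submodule Φ A where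
  carrier := {x | ∀ a ∈ I, x * a = 0}
  add_mem' hx hy a ha := by rw [add_mul, hx a ha, hy a ha, add_zero]
  zero_mem' a _ := zero_mul a
  smul_mem' c x hx a ha := by rw [smul_mul_assoc, hx a ha, smul_zero]

/-- The right annihilator of `I`. -/
def rightAnn (I : Submodule Φ A) : Submodule Φ A where
  carrier := {x | ∀ a ∈ I, a * x = 0}
  add_mem' hx hy a ha := by rw [mul_add, hx a ha, hy a ha, add_zero]
  zero_mem' a _ := mul_zero a
  smul_mem' c x hx a ha := by rw [mul_smul_comm, hx a ha, smul_zero]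

theorem IsIdeal.leftAnn {I : Submodule Φ A} (hI : IsIdeal I) : IsIdeal (leftAnn I) :=
  fun b x hx => ⟨fun a ha => by rw [mul_assoc, hx a ha, mul_zero],
    fun a ha => by rw [mul_assoc]; exact hx _ (hI b a ha).1⟩

theorem IsIdeal.rightAnn {I : Submodule Φ A} (hI : IsIdeal I) : IsIdeal (rightAnn I) :=
  fun b x hx => ⟨fun a ha => by rw [← mul_assoc]; exact hx _ (hI b a ha).2,
    fun a ha => by rw [← mul_assoc, hx a ha, zero_mul]⟩

theorem isEssentialIdeal_of_forall {I : Submodule Φ A} (hI : IsIdeal I)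
    (h : ∀ L : Submodule Φ A, IsIdeal L → ∀ x ∈ L, x ≠ 0 → ∃ z ∈ I, z ∈ L ∧ z ≠ 0) :
    IsEssentialIdeal I := by
  refine ⟨hI, fun L hL hne => ?_⟩
  obtain ⟨x, hx, hx0⟩ := (Submodule.ne_bot_iff L).1 hne
  obtain ⟨z, hzI, hzL, hz0⟩ := h L hL x hx hx0
  exact (Submodule.ne_bot_iff _).2 ⟨z, ⟨hzI, hzL⟩, hz0⟩

variable (Φ) in
theorem IsSemiprime.of_forall (h : ∀ x : A, (∀ a, x * a * x = 0) → x = 0) : IsSemiprime Φ A := by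
  refine ⟨fun I hI hne h0 => ?_⟩
  obtain ⟨x, hx, hx0⟩ := (Submodule.ne_bot_iff I).1 hne
  refine hx0 (h x fun a => ?_)
  have : x * a * x ∈ prod I I := mul_mem_prod (hI a x hx).2 hx
  rwa [h0, Submodule.mem_bot] at this

variable [IsSemiprime Φ A]

theorem IsEssentialIdeal.eq_zero_of_mul_right {I : Submodule Φ A} (hI : IsEssentialIdeal I)
    {x : A} (h : ∀ a ∈ I, x * a = 0) : x = 0 := by
  by_contra hx
  have hK : leftAnn I ≠ ⊥ := (Submodule.ne_bot_iff _).2 ⟨x, h, hx⟩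
  refine IsSemiprime.prod_self_ne_bot _ (hI.isIdeal.inf hI.isIdeal.leftAnn)
    (hI.inf_ne_bot _ hI.isIdeal.leftAnn hK) ?_
  rw [eq_bot_iff, prod_le]
  exact fun y hy z hz => hy.2 z hz.1

theorem IsEssentialIdeal.eq_zero_of_mul_left {I : Submodule Φ A} (hI : IsEssentialIdeal I)
    {x : A} (h : ∀ a ∈ I, a * x = 0) : x = 0 := by
  by_contra hx
  have hK : rightAnn I ≠ ⊥ := (Submodule.ne_bot_iff _).2 ⟨x, h, hx⟩
  refine IsSemiprime.prod_self_ne_bot _ (hI.isIdeal.inf hI.isIdeal.rightAnn)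
    (hI.inf_ne_bot _ hI.isIdeal.rightAnn hK) ?_
  rw [eq_bot_iff, prod_le]
  exact fun y hy z hz => hz.2 y hy.1

theorem eq_zero_of_forall_mul_right (Φ : Type v) [CommRing Φ] [Module Φ A]
    [IsScalarTower Φ A A] [SMulCommClass Φ A A] [IsSemiprime Φ A]
    {x : A} (h : ∀ a, x * a = 0) : x = 0 :=
  (IsEssentialIdeal.top (Φ := Φ)).eq_zero_of_mul_right fun a _ => h a

theorem eq_zero_of_forall_mul_left (Φ : Type v) [CommRing Φ] [Module Φ A]
    [IsScalarTower Φ A A] [SMulCommClass Φ A A] [IsSemiprime Φ A]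
    {x : A} (h : ∀ a, a * x = 0) : x = 0 :=
  (IsEssentialIdeal.top (Φ := Φ)).eq_zero_of_mul_left fun a _ => h a

/-- If `x A x = 0`, then `x` lies in the right annihilator `S` of `x A` and in the left annihilator
`W` of `A S`. Both are two-sided ideals, so `S ⊓ W` is a nilpotent ideal containing `x`. -/
theorem eq_zero_of_sandwich (Φ : Type v) [CommRing Φ] [Module Φ A]
    [IsScalarTower Φ A A] [SMulCommClass Φ A A] [IsSemiprime Φ A]
    {x : A} (h : ∀ a, x * a * x = 0) : x = 0 := by
  let S : Submodule Φ A := rightAnn (LinearMap.range (LinearMap.mulLeft Φ x))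
  have hS : IsIdeal S := by
    intro b z hz
    constructor
    · rintro _ ⟨a, rfl⟩
      have := hz _ ⟨a * b, rfl⟩
      simpa [mul_assoc] using this
    · intro y hy
      rw [← mul_assoc, hz y hy, zero_mul]
  have hxS : x ∈ S := by
    rintro _ ⟨a, rfl⟩
    exact h a
  let W : Submodule Φ A := leftAnn (prod ⊤ S)
  have hW : IsIdeal W := (IsIdeal.top.prod hS).leftAnn
  have hxW : x ∈ W := by
    have : prod (⊤ : Submodule Φ A) S ≤ rightAnn (Submodule.span Φ {x}) := by
      rw [prod_le]
      intro a _ z hz y hy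
      obtain ⟨c, rfl⟩ := Submodule.mem_span_singleton.1 hy
      rw [smul_mul_assoc, ← mul_assoc, show x * a * z = 0 from hz _ ⟨a, rfl⟩, smul_zero]
    exact fun y hy => this hy x (Submodule.mem_span_singleton_self x)
  have hI : IsIdeal (S ⊓ W) := hS.inf hW
  by_contra hx
  -- Without a unit, `W` is only known to kill `A S`, not `S`. Squaring twice puts the right factor
  -- into `A S`.
  refine IsSemiprime.prod_self_ne_bot _ (hI.prod hI) (IsSemiprime.prod_self_ne_bot _ hI
    ((Submodule.ne_bot_iff _).2 ⟨x, ⟨hxS, hxW⟩, hx⟩)) ?_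
  rw [eq_bot_iff, prod_le]
  intro y hy z hz
  exact (prod_le_left hI hy).2 z (prod_mono le_top inf_le_left hz)

/-- Moves a nonzero product into the corner `k A k`, which lies in the diagonal subalgebra when `k`
is in some `H i`. -/
theorem exists_sandwich_right_ne (Φ : Type v) [CommRing Φ] [Module Φ A]
    [IsScalarTower Φ A A] [SMulCommClass Φ A A] [IsSemiprime Φ A] {x k : A} (h : x * k ≠ 0) :
    ∃ b, k * (b * x) * k ≠ 0 := by
  by_contra! hb
  refine h (eq_zero_of_sandwich Φ fun a => ?_)
  rw [show x * k * a * (x * k) = x * (k * (a * x) * k) by simp only [mul_assoc], hb, mul_zero]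

theorem exists_sandwich_left_ne (Φ : Type v) [CommRing Φ] [Module Φ A]
    [IsScalarTower Φ A A] [SMulCommClass Φ A A] [IsSemiprime Φ A] {x k : A} (h : k * x ≠ 0) :
    ∃ b, k * (x * b) * k ≠ 0 := by
  by_contra! hb
  refine h (eq_zero_of_sandwich Φ fun a => ?_)
  rw [show k * x * a * (k * x) = k * (x * a) * k * x by simp only [mul_assoc], hb, zero_mul]

/-- For `a ∈ I` the element `x * a` satisfies the hypothesis of the global version, so `x I = 0`. -/
theorem IsEssentialIdeal.eq_zero_of_sandwich {I : Submodule Φ A} (hI : IsEssentialIdeal I)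
    {x : A} (h : ∀ a ∈ I, x * a * x = 0) : x = 0 := by
  refine hI.eq_zero_of_mul_right fun a ha => Martindale.eq_zero_of_sandwich Φ fun b => ?_
  have := h _ (hI.isIdeal b a ha).2
  rw [show x * a * b * (x * a) = x * (a * b) * x * a by simp only [mul_assoc], this, zero_mul]

end Semiprime

/-! ### How `A` multiplies in `Q_s(A)` -/

section Quotients

variable {Φ : Type v} {A : Type u} [CommRing Φ] [NonUnitalRing A] [Module Φ A]
  [IsScalarTower Φ A A] [SMulCommClass Φ A A] [IsSemiprime Φ A]

namespace Qs

open CompatiblePair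

theorem exists_mk (s : Qs Φ A) : ∃ p, mk p = s := Quotient.exists_rep s

theorem of_mul_mk (p : CompatiblePair Φ A) (x : p.dom) : of Φ A x * mk p = of Φ A (p.f x) := by
  refine sound (rel_of (fun y h _ => ?_) (fun y h _ => ?_))
  · exact p.f_mul y x x.2
  · exact (p.compat x ⟨y, prod_le_left p.essential.isIdeal h⟩).symm

theorem mk_mul_of (p : CompatiblePair Φ A) (x : p.dom) : mk p * of Φ A x = of Φ A (p.g x) := by
  refine sound (rel_of (fun y h _ => ?_) (fun y h _ => ?_))
  · exact p.compat ⟨y, prod_le_right p.essential.isIdeal h⟩ x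
  · exact p.g_mul y x x.2

theorem of_injective : Function.Injective (of Φ A) := by
  intro a b hab
  obtain ⟨K, hK, _, _, h⟩ := Quotient.exact hab
  rw [← sub_eq_zero]
  refine hK.eq_zero_of_mul_left fun x hx => ?_
  rw [mul_sub, sub_eq_zero]
  exact (h x hx).1

/-- The left homomorphism of a pair determines the right one: `a * g x = f a * x` vanishes for all
`a` in an essential ideal, hence so does `g x`. -/
theorem eq_zero_of_of_mul {K : Submodule Φ A} (hK : IsEssentialIdeal K) {s : Qs Φ A}
    (h : ∀ x ∈ K, of Φ A x * s = 0) : s = 0 := by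
  obtain ⟨p, rfl⟩ := exists_mk s
  have hf : ∀ x (hx : x ∈ p.dom), x ∈ K → p.f ⟨x, hx⟩ = 0 := fun x hx hxK => by
    apply of_injective (Φ := Φ)
    rw [← of_mul_mk p ⟨x, hx⟩, map_zero]
    exact h x hxK
  refine sound ⟨p.dom ⊓ K, p.essential.inf hK, inf_le_left, le_top, fun x hx => ⟨?_, ?_⟩⟩
  · exact (hf x hx.1 hx.2).trans (mul_zero x).symm
  · refine Eq.trans ?_ (zero_mul x).symm
    refine (p.essential.inf hK).eq_zero_of_mul_left fun a ha => ?_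
    have := p.compat ⟨a, ha.1⟩ ⟨x, hx.1⟩
    rw [hf a ha.1 ha.2, zero_mul] at this
    exact this.symm

theorem eq_zero_of_mul_of {K : Submodule Φ A} (hK : IsEssentialIdeal K) {s : Qs Φ A}
    (h : ∀ x ∈ K, s * of Φ A x = 0) : s = 0 := by
  obtain ⟨p, rfl⟩ := exists_mk s
  refine eq_zero_of_of_mul p.essential fun x hx => ?_
  rw [of_mul_mk p ⟨x, hx⟩]
  have : p.f ⟨x, hx⟩ = 0 := by
    refine hK.eq_zero_of_mul_right fun a ha => ?_
    apply of_injective (Φ := Φ)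
    rw [map_mul, ← of_mul_mk, mul_assoc, h a ha, mul_zero, map_zero]
  rw [this, map_zero]

end Qs

/-! ### A characterization of `Q_s(A)` up to isomorphism -/

section Characterization

variable {Q : Type*} [Ring Q] [Algebra Φ Q]

variable (Φ A Q) in
/-- The properties that characterize `Q_s(A)` among the algebras to which `A` maps. -/
structure IsSymmetricQuotient (ι : A →ₙₐ[Φ] Q) : Prop where
  injective : Function.Injective ι
  exists_ideal : ∀ q : Q, ∃ I : Submodule Φ A, IsEssentialIdeal I ∧
    ∀ x ∈ I, (∃ b, ι x * q = ι b) ∧ ∃ c, q * ι x = ι c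
  eq_zero : ∀ (I : Submodule Φ A) (q : Q), IsEssentialIdeal I → (∀ x ∈ I, ι x * q = 0) → q = 0
  exists_eq : ∀ p : CompatiblePair Φ A, ∃ q : Q, ∀ x : p.dom, ι x * q = ι (p.f x)

namespace IsSymmetricQuotient

open CompatiblePair

/-- The relation matching the elements of two algebras of quotients that act alike. -/
def Match (ι : A →ₙₐ[Φ] Q) (q : Q) (s : Qs Φ A) : Prop :=
  ∃ K : Submodule Φ A, IsEssentialIdeal K ∧
    ∀ x ∈ K, ∃ b, ι x * q = ι b ∧ Qs.of Φ A x * s = Qs.of Φ A b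

variable {ι : A →ₙₐ[Φ] Q}

theorem Match.add {q q' : Q} {s s' : Qs Φ A} :
    Match ι q s → Match ι q' s' → Match ι (q + q') (s + s') := by
  rintro ⟨K, hK, h⟩ ⟨L, hL, h'⟩
  refine ⟨K ⊓ L, hK.inf hL, fun x hx => ?_⟩
  obtain ⟨b, hb, hb'⟩ := h x hx.1
  obtain ⟨c, hc, hc'⟩ := h' x hx.2
  exact ⟨b + c, by rw [mul_add, hb, hc, map_add], by rw [mul_add, hb', hc', map_add]⟩

theorem Match.smul (c : Φ) {q : Q} {s : Qs Φ A} :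
    Match ι q s → Match ι (c • q) (c • s) := by
  rintro ⟨K, hK, h⟩
  refine ⟨K, hK, fun x hx => ?_⟩
  obtain ⟨b, hb, hb'⟩ := h x hx
  exact ⟨c • b, by rw [mul_smul_comm, hb, map_smul], by rw [mul_smul_comm, hb', map_smul]⟩

theorem Match.mul {q q' : Q} {s s' : Qs Φ A} :
    Match ι q s → Match ι q' s' → Match ι (q * q') (s * s') := by
  rintro ⟨K, hK, h⟩ ⟨L, hL, h'⟩
  refine ⟨Martindale.prod L K, hL.prod hK, fun x hx => ?_⟩
  obtain ⟨b, hb, hb'⟩ := h x (prod_le_right hK.isIdeal hx)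
  -- The domain is `L K`, in this order, because `(y z) s = y (z s)` stays in `L` for `y ∈ L`; the
  -- second factor can then be applied.
  have hbL : b ∈ L := by
    have key : Martindale.prod L K ≤
        (L.map (Qs.of Φ A : A →ₗ[Φ] Qs Φ A)).comap
        ((LinearMap.mulRight Φ s).comp (Qs.of Φ A : A →ₗ[Φ] Qs Φ A)) := by
      rw [prod_le]
      intro y hy z hz
      obtain ⟨c, _, hc⟩ := h z hz
      refine ⟨y * c, (hL.isIdeal c y hy).2, ?_⟩
      change Qs.of Φ A (y * c) = Qs.of Φ A (y * z) * s
      rw [map_mul, map_mul, mul_assoc, hc]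
    obtain ⟨d, hd, hd'⟩ := key hx
    have : Qs.of Φ A d = Qs.of Φ A b := hd'.trans hb'
    rwa [← Qs.of_injective this]
  obtain ⟨c, hc, hc'⟩ := h' b hbL
  exact ⟨c, by rw [← mul_assoc, hb, hc], by rw [← mul_assoc, hb', hc']⟩

theorem Match.of (a : A) : Match ι (ι a) (Qs.of Φ A a) :=
  ⟨⊤, IsEssentialIdeal.top, fun x _ => ⟨x * a, (map_mul _ _ _).symm, (map_mul _ _ _).symm⟩⟩

theorem Match.one : Match ι 1 (1 : Qs Φ A) :=
  ⟨⊤, IsEssentialIdeal.top, fun x _ => ⟨x, mul_one _, mul_one _⟩⟩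

theorem Match.right_unique {q : Q} {s s' : Qs Φ A} (hι : IsSymmetricQuotient Φ A Q ι) :
    Match ι q s → Match ι q s' → s = s' := by
  rintro ⟨K, hK, h⟩ ⟨L, hL, h'⟩
  rw [← sub_eq_zero]
  refine Qs.eq_zero_of_of_mul (hK.inf hL) fun x hx => ?_
  obtain ⟨b, hb, hb'⟩ := h x hx.1
  obtain ⟨c, hc, hc'⟩ := h' x hx.2
  rw [mul_sub, hb', hc', hι.injective (hb.symm.trans hc), sub_self]

theorem Match.left_unique {q q' : Q} {s : Qs Φ A} (hι : IsSymmetricQuotient Φ A Q ι) :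
    Match ι q s → Match ι q' s → q = q' := by
  rintro ⟨K, hK, h⟩ ⟨L, hL, h'⟩
  rw [← sub_eq_zero]
  refine hι.eq_zero _ _ (hK.inf hL) fun x hx => ?_
  obtain ⟨b, hb, hb'⟩ := h x hx.1
  obtain ⟨c, hc, hc'⟩ := h' x hx.2
  rw [mul_sub, hb, hc, Qs.of_injective (hb'.symm.trans hc'), sub_self]

theorem exists_match_left (hι : IsSymmetricQuotient Φ A Q ι) (s : Qs Φ A) : ∃ q, Match ι q s := by
  obtain ⟨p, rfl⟩ := Qs.exists_mk s
  obtain ⟨q, hq⟩ := hι.exists_eq p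
  exact ⟨q, p.dom, p.essential, fun x hx => ⟨p.f ⟨x, hx⟩, hq ⟨x, hx⟩, Qs.of_mul_mk p ⟨x, hx⟩⟩⟩

/-- Right and left multiplication by `q` on the ideal of `exists_ideal` form a compatible pair,
compatibility being associativity. -/
theorem exists_match_right (hι : IsSymmetricQuotient Φ A Q ι) (q : Q) : ∃ s, Match ι q s := by
  obtain ⟨I, hI, h⟩ := hι.exists_ideal q
  choose f hf using fun x : I => (h x x.2).1
  choose g hg using fun x : I => (h x x.2).2
  refine ⟨Qs.mk ⟨I, hI, ⟨⟨f, fun x y => ?_⟩, fun c x => ?_⟩, ⟨⟨g, fun x y => ?_⟩, fun c x => ?_⟩,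
    fun a x hx => ?_, fun a x hx => ?_, fun x y => ?_⟩, I, hI, fun x hx =>
      ⟨f ⟨x, hx⟩, hf ⟨x, hx⟩, Qs.of_mul_mk (Φ := Φ) ⟨I, hI, _, _, _, _, _⟩ ⟨x, hx⟩⟩⟩
  all_goals apply hι.injective
  · simp only [map_add, ← hf, Submodule.coe_add, add_mul]
  · simp only [map_smul, ← hf, Submodule.coe_smul, smul_mul_assoc, RingHom.id_apply]
  · simp only [map_add, ← hg, Submodule.coe_add, mul_add]
  · simp only [map_smul, ← hg, Submodule.coe_smul, mul_smul_comm, RingHom.id_apply]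
  · simp only [LinearMap.coe_mk, AddHom.coe_mk, map_mul, ← hf, mul_assoc]
  · simp only [LinearMap.coe_mk, AddHom.coe_mk, map_mul, ← hg, mul_assoc]
  · simp only [LinearMap.coe_mk, AddHom.coe_mk, map_mul, ← hg, ← hf, mul_assoc]

/-- `Match` is the graph of a bijection and respects all operations. -/
theorem exists_algEquiv (hι : IsSymmetricQuotient Φ A Q ι) :
    ∃ φ : Q ≃ₐ[Φ] Qs Φ A, ∀ a, φ (ι a) = Qs.of Φ A a := by
  choose t ht using hι.exists_match_right
  have hu : ∀ {q s}, Match ι q s → t q = s := fun h => Match.right_unique hι (ht _) h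
  let φ : Q →ₐ[Φ] Qs Φ A := AlgHom.ofLinearMap
    ⟨⟨t, fun a b => hu ((ht a).add (ht b))⟩, fun c a => hu ((ht a).smul c)⟩
    (hu Match.one) (fun a b => hu ((ht a).mul (ht b)))
  refine ⟨AlgEquiv.ofBijective φ ⟨fun a b hab => ?_, fun s => ?_⟩, fun a => hu (Match.of a)⟩
  · have hab : t a = t b := hab
    have := ht a
    rw [hab] at this
    exact Match.left_unique hι this (ht b)
  · obtain ⟨q, hq⟩ := hι.exists_match_left s
    exact ⟨q, hu hq⟩

end IsSymmetricQuotient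

end Characterization

end Quotients

/-! ### Peirce systems: passing between `A` and its diagonal `B` -/

section Peirce

variable {Φ : Type v} {A : Type u} [CommRing Φ] [NonUnitalRing A] [Module Φ A]
  [IsScalarTower Φ A A] [SMulCommClass Φ A A]

/-- Maps such as `a h ↦ δ_ij a h` are given on generators of a product. A linear relation that
contains the generating pairs and is single-valued takes care of well-definedness. -/
theorem exists_linearMap_of_graph {M N : Type*} [AddCommGroup M] [Module Φ M] [AddCommGroup N]
    [Module Φ N] (G : Submodule Φ (M × N)) (hG : ∀ z, ((0 : M), z) ∈ G → z = 0)
    (D : Submodule Φ M) (hD : D ≤ G.map (LinearMap.fst Φ M N)) :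
    ∃ f : D →ₗ[Φ] N, ∀ x : D, ((x : M), f x) ∈ G := by
  have hex : ∀ x : D, ∃ z, ((x : M), z) ∈ G := by
    intro x
    obtain ⟨⟨y, z⟩, hyz, hy⟩ := hD x.2
    have hy : y = x := hy
    exact ⟨z, hy ▸ hyz⟩
  have hu : ∀ {x : M} {z w : N}, (x, z) ∈ G → (x, w) ∈ G → z = w := by
    intro x z w hz hw
    have := G.sub_mem hz hw
    rw [Prod.mk_sub_mk, sub_self] at this
    exact sub_eq_zero.1 (hG _ this)
  choose f hf using hex
  exact ⟨⟨⟨f, fun x y => hu (hf _) (G.add_mem (hf x) (hf y))⟩,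
    fun c x => hu (hf _) (G.smul_mem c (hf x))⟩, hf⟩

/-- A family of submodules `H i` of a subalgebra `B` of `A` that behave as the diagonal corners of
a Peirce decomposition of `A` with diagonal `B`. -/
structure PeirceSystem {ι : Type*} (B : NonUnitalSubalgebra Φ A) (H : ι → Submodule Φ A) :
    Prop where
  le : ∀ i, H i ≤ B.toSubmodule
  le_iSup : B.toSubmodule ≤ ⨆ i, H i
  mul_eq_zero : ∀ {i j x y}, i ≠ j → x ∈ H i → y ∈ H j → x * y = 0
  corner : ∀ {i x y} (a : A), x ∈ H i → y ∈ H i → x * a * y ∈ B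
  mul_mem_left : ∀ {i b x}, b ∈ B → x ∈ H i → b * x ∈ H i
  mul_mem_right : ∀ {i b x}, b ∈ B → x ∈ H i → x * b ∈ H i
  le_sandwich : ∀ i, H i ≤ prod (prod (H i) ⊤) (H i)
  full : prod (prod B.toSubmodule ⊤) B.toSubmodule = ⊤

/-- The inclusion of a subalgebra as a linear map. -/
def incl (B : NonUnitalSubalgebra Φ A) : B →ₗ[Φ] A :=
  (NonUnitalSubalgebraClass.subtype B : B →ₙₐ[Φ] A)

theorem IsIdeal.comap_incl {B : NonUnitalSubalgebra Φ A} {I : Submodule Φ A} (hI : IsIdeal I) :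
    IsIdeal (I.comap (incl B)) :=
  fun b x hx => hI b x hx

namespace PeirceSystem

variable {ι : Type*} {B : NonUnitalSubalgebra Φ A} {H : ι → Submodule Φ A}

theorem top_prod (P : PeirceSystem B H) : prod ⊤ B.toSubmodule = ⊤ :=
  top_le_iff.1 (P.full.ge.trans (prod_mono le_top le_rfl))

theorem prod_top (P : PeirceSystem B H) : prod B.toSubmodule ⊤ = ⊤ := by
  refine top_le_iff.1 (P.full.ge.trans (prod_le.2 fun x hx y _ => ?_))
  have h : prod B.toSubmodule ⊤ ≤ (prod B.toSubmodule ⊤).comap (LinearMap.mulRight Φ y) := by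
    rw [prod_le]
    intro b hb a _
    simp only [Submodule.mem_comap, LinearMap.mulRight_apply, mul_assoc]
    exact mul_mem_prod hb Submodule.mem_top
  exact h hx

/-- A submodule that contains all `A H_i` is everything. -/
theorem mem_of_mul_mem (P : PeirceSystem B H) {M : Submodule Φ A}
    (h : ∀ a i, ∀ k ∈ H i, a * k ∈ M) (x : A) : x ∈ M := by
  have : prod ⊤ B.toSubmodule ≤ M := by
    rw [prod_le]
    intro a _ b hb
    have hH : ⨆ i, H i ≤ M.comap (LinearMap.mulLeft Φ a) := iSup_le fun i k hk => h a i k hk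
    exact hH (P.le_iSup hb)
  exact this (P.top_prod.ge Submodule.mem_top)

/-- A submodule that contains all `H_i A` is everything. -/
theorem mem_of_mul_mem' (P : PeirceSystem B H) {M : Submodule Φ A}
    (h : ∀ a i, ∀ k ∈ H i, k * a ∈ M) (x : A) : x ∈ M := by
  have : prod B.toSubmodule ⊤ ≤ M := by
    rw [prod_le]
    intro b hb a _
    have hH : ⨆ i, H i ≤ M.comap (LinearMap.mulRight Φ a) := iSup_le fun i k hk => h a i k hk
    exact hH (P.le_iSup hb)
  exact this (P.prod_top.ge Submodule.mem_top)

variable [IsSemiprime Φ A]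

theorem eq_zero_of_mul_left (P : PeirceSystem B H) {x : A} (h : ∀ i, ∀ k ∈ H i, k * x = 0) :
    x = 0 := by
  refine eq_zero_of_forall_mul_left Φ fun a => ?_
  have := P.mem_of_mul_mem (M := leftAnn (Submodule.span Φ {x})) (fun a i k hk y hy => ?_) a
  · exact this x (Submodule.mem_span_singleton_self x)
  · obtain ⟨c, rfl⟩ := Submodule.mem_span_singleton.1 hy
    rw [mul_smul_comm, mul_assoc, h i k hk, mul_zero, smul_zero]

theorem eq_zero_of_mul_right (P : PeirceSystem B H) {x : A} (h : ∀ i, ∀ k ∈ H i, x * k = 0) :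
    x = 0 := by
  refine eq_zero_of_forall_mul_right Φ fun a => ?_
  have := P.mem_of_mul_mem' (M := rightAnn (Submodule.span Φ {x})) (fun a i k hk y hy => ?_) a
  · exact this x (Submodule.mem_span_singleton_self x)
  · obtain ⟨c, rfl⟩ := Submodule.mem_span_singleton.1 hy
    rw [smul_mul_assoc, ← mul_assoc, h i k hk, zero_mul, smul_zero]

theorem exists_mul_left_ne (P : PeirceSystem B H) {x : A} (hx : x ≠ 0) :
    ∃ i, ∃ k ∈ H i, k * x ≠ 0 := by
  contrapose! hx
  exact P.eq_zero_of_mul_left hx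

theorem exists_mul_right_ne (P : PeirceSystem B H) {x : A} (hx : x ≠ 0) :
    ∃ i, ∃ k ∈ H i, x * k ≠ 0 := by
  contrapose! hx
  exact P.eq_zero_of_mul_right hx

/-- Choose `k ∈ H i` and then `l ∈ H j` with `k x l ≠ 0`. As `k x` is still in `H i`, orthogonality
leaves only `i = j`. -/
theorem exists_corner_ne (P : PeirceSystem B H) {x : A} (hxB : x ∈ B) (hx : x ≠ 0) :
    ∃ i, ∃ k ∈ H i, ∃ l ∈ H i, k * x * l ≠ 0 := by
  obtain ⟨i, k, hk, h⟩ := P.exists_mul_left_ne hx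
  obtain ⟨j, l, hl, h'⟩ := P.exists_mul_right_ne h
  by_cases hij : i = j
  · subst hij
    exact ⟨i, k, hk, l, hl, h'⟩
  · exact (h' (P.mul_eq_zero hij (P.mul_mem_right hxB hk) hl)).elim

theorem isSemiprime (P : PeirceSystem B H) : IsSemiprime Φ B := by
  refine IsSemiprime.of_forall Φ fun x hx => ?_
  by_contra hx0
  obtain ⟨i, k, hk, l, hl, hne⟩ := P.exists_corner_ne x.2 fun h => hx0 (Subtype.ext h)
  refine hne (eq_zero_of_sandwich Φ fun a => ?_)
  have h : (x : A) * (l * a * k) * x = 0 := congrArg Subtype.val (hx ⟨_, P.corner a hl hk⟩)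
  rw [show k * x * l * a * (k * x * l) = k * (x * (l * a * k) * x) * l by simp only [mul_assoc], h,
    mul_zero, zero_mul]

/-- For `0 ≠ x ∈ L` some corner `k x l` is nonzero, hence `k x l a k x l ≠ 0` for some `a ∈ I`. Then
`l a k` lies in `I` and in `B`, and `x (l a k) x` is a nonzero element of both ideals. -/
theorem isEssentialIdeal_comap (P : PeirceSystem B H) {I : Submodule Φ A}
    (hI : IsEssentialIdeal I) : IsEssentialIdeal (I.comap (incl B)) := by
  refine isEssentialIdeal_of_forall hI.isIdeal.comap_incl fun L hL x hx hx0 => ?_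
  obtain ⟨i, k, hk, l, hl, hne⟩ := P.exists_corner_ne x.2 fun h => hx0 (Subtype.ext h)
  obtain ⟨a, ha, hne'⟩ : ∃ a ∈ I, k * x * l * a * (k * x * l) ≠ 0 := by
    by_contra! h
    exact hne (hI.eq_zero_of_sandwich h)
  let c : B := ⟨l * a * k, P.corner a hl hk⟩
  have hc : (c : A) ∈ I := (hI.isIdeal k _ (hI.isIdeal l a ha).1).2
  refine ⟨x * c * x, ?_, (hL _ _ hx).1, fun h => hne' ?_⟩
  · exact (hI.isIdeal (x : A) _ (hI.isIdeal (x : A) _ hc).1).2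
  · have h : (x : A) * (l * a * k) * x = 0 := congrArg Subtype.val h
    rw [show k * x * l * a * (k * x * l) = k * (x * (l * a * k) * x) * l by simp only [mul_assoc],
      h, mul_zero, zero_mul]

variable [IsSemiprime Φ B]

/-- If `y ≠ 0`, some `k (b y) k` is a nonzero element of `B`, and it still annihilates `I` because
`k I ⊆ I`. -/
theorem eq_zero_of_mul_ideal (P : PeirceSystem B H) {I : Submodule Φ B} (hI : IsEssentialIdeal I)
    {y : A} (h : ∀ x ∈ I, y * (x : A) = 0) : y = 0 := by
  by_contra hy
  obtain ⟨i, k, hk, hne⟩ := P.exists_mul_right_ne hy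
  obtain ⟨b, hb⟩ := exists_sandwich_right_ne Φ hne
  refine hb (congrArg Subtype.val (hI.eq_zero_of_mul_right
    (x := (⟨k * (b * y) * k, P.corner _ hk hk⟩ : B)) fun x hx => Subtype.ext ?_))
  change k * (b * y) * k * (x : A) = 0
  have := h _ (hI.isIdeal ⟨k, P.le i hk⟩ x hx).1
  change y * (k * (x : A)) = 0 at this
  simp only [mul_assoc, this, mul_zero]

theorem eq_zero_of_ideal_mul (P : PeirceSystem B H) {I : Submodule Φ B} (hI : IsEssentialIdeal I)
    {y : A} (h : ∀ x ∈ I, (x : A) * y = 0) : y = 0 := by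
  by_contra hy
  obtain ⟨i, k, hk, hne⟩ := P.exists_mul_left_ne hy
  obtain ⟨b, hb⟩ := exists_sandwich_left_ne Φ hne
  refine hb (congrArg Subtype.val (hI.eq_zero_of_mul_left
    (x := (⟨k * (y * b) * k, P.corner _ hk hk⟩ : B)) fun x hx => Subtype.ext ?_))
  change (x : A) * (k * (y * b) * k) = 0
  have := h _ (hI.isIdeal ⟨k, P.le i hk⟩ x hx).2
  change (x : A) * k * y = 0 at this
  simp only [← mul_assoc, this, zero_mul]

/-- For each `j`, the `x` with `x A H_j ⊆ A I` form an essential ideal `K j`. The intersection of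
these finitely many ideals, multiplied by `A`, lies in `A I` since `A = ∑ A H_j`. -/
theorem exists_essential_le_left (P : PeirceSystem B H) [Finite ι] {I : Submodule Φ B}
    (hI : IsEssentialIdeal I) :
    ∃ D : Submodule Φ A, IsEssentialIdeal D ∧ D ≤ prod ⊤ (I.map (incl B)) := by
  have := Fintype.ofFinite ι
  have hM : ∀ a, ∀ x ∈ prod ⊤ (I.map (incl B)), a * x ∈ prod ⊤ (I.map (incl B)) := by
    intro a x hx
    have h : prod ⊤ (I.map (incl B)) ≤
        (prod ⊤ (I.map (incl B))).comap (LinearMap.mulLeft Φ a) := by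
      rw [prod_le]
      intro y _ z hz
      simp only [Submodule.mem_comap, LinearMap.mulLeft_apply, ← mul_assoc]
      exact mul_mem_prod Submodule.mem_top hz
    exact h hx
  let K : ι → Submodule Φ A := fun j =>
    { carrier := {x | ∀ a, ∀ k ∈ H j, x * a * k ∈ prod ⊤ (I.map (incl B))}
      add_mem' := fun hx hy a k hk => by
        rw [add_mul, add_mul]
        exact add_mem (hx a k hk) (hy a k hk)
      zero_mem' := fun a k _ => by
        rw [zero_mul, zero_mul]
        exact zero_mem _
      smul_mem' := fun c x hx a k hk => by
        rw [smul_mul_assoc, smul_mul_assoc]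
        exact Submodule.smul_mem _ c (hx a k hk) }
  have hK : ∀ j, IsEssentialIdeal (K j) := by
    intro j
    refine isEssentialIdeal_of_forall (fun b x hx => ⟨fun a k hk => ?_, fun a k hk => ?_⟩) ?_
    · simpa only [mul_assoc] using hM b _ (hx a k hk)
    · rw [mul_assoc x]
      exact hx (b * a) k hk
    intro L hL x hx hx0
    -- If `L H_j = 0`, then `L ⊆ K j` outright. Otherwise `L` contains a nonzero `w = k b z k` in
    -- `B`, and `w c w` with `c ∈ I` is the required element: `c` times the corner element `k b z k
    -- a l` stays in `I`.
    by_cases h : ∀ z ∈ L, ∀ k ∈ H j, z * k = 0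
    · refine ⟨x, fun a k hk => ?_, hx, hx0⟩
      rw [h _ (hL a x hx).2 k hk]
      exact zero_mem _
    push Not at h
    obtain ⟨z, hz, k, hk, hne⟩ := h
    obtain ⟨b, hb⟩ := exists_sandwich_right_ne Φ hne
    let w : B := ⟨k * (b * z) * k, P.corner _ hk hk⟩
    have hw : w ≠ 0 := fun h => hb (congrArg Subtype.val h)
    obtain ⟨c, hc, hne'⟩ : ∃ c ∈ I, w * c * w ≠ 0 := by
      by_contra! h
      exact hw (hI.eq_zero_of_sandwich h)
    refine ⟨_, fun a l hl => ?_, ?_, fun h => hne' (Subtype.ext h)⟩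
    · have : ((w * c * w : B) : A) * a * l =
          w * ((c * (⟨k * (b * z * k * a) * l, P.corner _ hk hl⟩ : B) : B) : A) := by
        change (w : A) * c * (k * (b * z) * k) * a * l = w * (c * (k * (b * z * k * a) * l))
        simp only [mul_assoc]
      rw [this]
      exact mul_mem_prod Submodule.mem_top ⟨_, (hI.isIdeal _ c hc).2, rfl⟩
    · have hwL : (w : A) ∈ L := (hL k _ (hL k _ (hL b z hz).1).1).2
      exact (hL _ _ hwL).1
  have hE : IsEssentialIdeal (Finset.univ.inf K) :=
    Finset.inf_induction IsEssentialIdeal.top (fun _ h _ h' => h.inf h') fun j _ => hK j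
  refine ⟨_, hE.prod IsEssentialIdeal.top, prod_le.2 fun x hx a _ => ?_⟩
  exact P.mem_of_mul_mem (M := (prod ⊤ (I.map (incl B))).comap (LinearMap.mulLeft Φ x))
    (fun a j k hk => by
      simpa only [Submodule.mem_comap, LinearMap.mulLeft_apply, mul_assoc] using
        (Finset.inf_le (Finset.mem_univ j) : Finset.univ.inf K ≤ K j) hx a k hk) a

theorem exists_essential_le_right (P : PeirceSystem B H) [Finite ι] {I : Submodule Φ B}
    (hI : IsEssentialIdeal I) :
    ∃ D : Submodule Φ A, IsEssentialIdeal D ∧ D ≤ prod (I.map (incl B)) ⊤ := by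
  have := Fintype.ofFinite ι
  have hM : ∀ a, ∀ x ∈ prod (I.map (incl B)) ⊤, x * a ∈ prod (I.map (incl B)) ⊤ := by
    intro a x hx
    have h : prod (I.map (incl B)) ⊤ ≤
        (prod (I.map (incl B)) ⊤).comap (LinearMap.mulRight Φ a) := by
      rw [prod_le]
      intro y hy z _
      simp only [Submodule.mem_comap, LinearMap.mulRight_apply, mul_assoc]
      exact mul_mem_prod hy Submodule.mem_top
    exact h hx
  let K : ι → Submodule Φ A := fun j =>
    { carrier := {x | ∀ a, ∀ k ∈ H j, k * (a * x) ∈ prod (I.map (incl B)) ⊤}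
      add_mem' := fun hx hy a k hk => by
        rw [mul_add, mul_add]
        exact add_mem (hx a k hk) (hy a k hk)
      zero_mem' := fun a k _ => by
        rw [mul_zero, mul_zero]
        exact zero_mem _
      smul_mem' := fun c x hx a k hk => by
        rw [mul_smul_comm, mul_smul_comm]
        exact Submodule.smul_mem _ c (hx a k hk) }
  have hK : ∀ j, IsEssentialIdeal (K j) := by
    intro j
    refine isEssentialIdeal_of_forall (fun b x hx => ⟨fun a k hk => ?_, fun a k hk => ?_⟩) ?_
    · rw [← mul_assoc a]
      exact hx (a * b) k hk
    · simpa only [mul_assoc] using hM b _ (hx a k hk)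
    intro L hL x hx hx0
    by_cases h : ∀ z ∈ L, ∀ k ∈ H j, k * z = 0
    · refine ⟨x, fun a k hk => ?_, hx, hx0⟩
      rw [h _ (hL a x hx).1 k hk]
      exact zero_mem _
    push Not at h
    obtain ⟨z, hz, k, hk, hne⟩ := h
    obtain ⟨b, hb⟩ := exists_sandwich_left_ne Φ hne
    let w : B := ⟨k * (z * b) * k, P.corner _ hk hk⟩
    have hw : w ≠ 0 := fun h => hb (congrArg Subtype.val h)
    obtain ⟨c, hc, hne'⟩ : ∃ c ∈ I, w * c * w ≠ 0 := by
      by_contra! h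
      exact hw (hI.eq_zero_of_sandwich h)
    refine ⟨_, fun a l hl => ?_, ?_, fun h => hne' (Subtype.ext h)⟩
    · have : l * (a * ((w * c * w : B) : A)) =
          (((⟨l * (a * k * (z * b)) * k, P.corner _ hl hk⟩ : B) * c : B) : A) * w := by
        change l * (a * (k * (z * b) * k * c * w)) = l * (a * k * (z * b)) * k * c * w
        simp only [mul_assoc]
      rw [this]
      exact mul_mem_prod ⟨_, (hI.isIdeal _ c hc).1, rfl⟩ Submodule.mem_top
    · have hwL : (w : A) ∈ L := (hL k _ (hL k _ (hL b z hz).2).1).2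
      exact (hL _ _ hwL).1
  have hE : IsEssentialIdeal (Finset.univ.inf K) :=
    Finset.inf_induction IsEssentialIdeal.top (fun _ h _ h' => h.inf h') fun j _ => hK j
  refine ⟨_, IsEssentialIdeal.top.prod hE, prod_le.2 fun a _ x hx => ?_⟩
  exact P.mem_of_mul_mem' (M := (prod (I.map (incl B)) ⊤).comap (LinearMap.mulRight Φ x))
    (fun a j k hk => by
      simpa only [Submodule.mem_comap, LinearMap.mulRight_apply, mul_assoc] using
        (Finset.inf_le (Finset.mem_univ j) : Finset.univ.inf K ≤ K j) hx a k hk) a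

/-- A compatible pair on an essential ideal of `B` extends to one on an essential ideal of `A`. -/
theorem exists_extension (P : PeirceSystem B H) [Finite ι] (p : CompatiblePair Φ B) :
    ∃ r : CompatiblePair Φ A, ∀ (x : r.dom) (y : p.dom),
      ((y : B) : A) * r.g x = (p.f y : A) * x := by
  obtain ⟨D, hD, hDI⟩ := P.exists_essential_le_left p.essential
  obtain ⟨E, hE, hEI⟩ := P.exists_essential_le_right p.essential
  -- The extension sends `a x` to `a * p.f x`. The relation is phrased through `p.g`, which makes it
  -- single-valued: `z I = 0` forces `z = 0`.
  let Gf : Submodule Φ (A × A) :=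
    { carrier := {w | ∀ y : p.dom, w.2 * ((y : B) : A) = w.1 * (p.g y : A)}
      add_mem' := fun {w w'} h h' y => by
        rw [Prod.snd_add, Prod.fst_add, add_mul, add_mul, h y, h' y]
      zero_mem' := fun y => by simp
      smul_mem' := fun c w h y => by
        rw [Prod.smul_snd, Prod.smul_fst, smul_mul_assoc, smul_mul_assoc, h y] }
  let Gg : Submodule Φ (A × A) :=
    { carrier := {w | ∀ y : p.dom, ((y : B) : A) * w.2 = (p.f y : A) * w.1}
      add_mem' := fun {w w'} h h' y => by
        rw [Prod.snd_add, Prod.fst_add, mul_add, mul_add, h y, h' y]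
      zero_mem' := fun y => by simp
      smul_mem' := fun c w h y => by
        rw [Prod.smul_snd, Prod.smul_fst, mul_smul_comm, mul_smul_comm, h y] }
  have compat (x y : p.dom) : (p.f x : A) * ((y : B) : A) = ((x : B) : A) * (p.g y : A) :=
    congrArg Subtype.val (p.compat x y)
  have hf0 : ∀ z, ((0 : A), z) ∈ Gf → z = 0 := fun z hz =>
    P.eq_zero_of_mul_ideal p.essential fun y hy => (hz ⟨y, hy⟩).trans (zero_mul _)
  have hg0 : ∀ z, ((0 : A), z) ∈ Gg → z = 0 := fun z hz =>
    P.eq_zero_of_ideal_mul p.essential fun y hy => (hz ⟨y, hy⟩).trans (mul_zero _)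
  have hfu : ∀ {x z w}, (x, z) ∈ Gf → (x, w) ∈ Gf → z = w := fun hz hw =>
    sub_eq_zero.1 (hf0 _ (by simpa using Gf.sub_mem hz hw))
  have hgu : ∀ {x z w}, (x, z) ∈ Gg → (x, w) ∈ Gg → z = w := fun hz hw =>
    sub_eq_zero.1 (hg0 _ (by simpa using Gg.sub_mem hz hw))
  have hfa : ∀ a (x : p.dom), (a * ((x : B) : A), a * (p.f x : A)) ∈ Gf := fun a x y => by
    change a * (p.f x : A) * ((y : B) : A) = a * ((x : B) : A) * (p.g y : A)
    rw [mul_assoc, mul_assoc, compat]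
  have hga : ∀ a (x : p.dom), (((x : B) : A) * a, (p.g x : A) * a) ∈ Gg := fun a x y => by
    change ((y : B) : A) * ((p.g x : A) * a) = (p.f y : A) * (((x : B) : A) * a)
    rw [← mul_assoc, ← mul_assoc, compat]
  obtain ⟨f, hf⟩ := exists_linearMap_of_graph Gf hf0 (D ⊓ E) (inf_le_left.trans (hDI.trans (by
    rw [prod_le]
    rintro a - _ ⟨x, hx, rfl⟩
    exact ⟨_, hfa a ⟨x, hx⟩, rfl⟩)))
  obtain ⟨g, hg⟩ := exists_linearMap_of_graph Gg hg0 (D ⊓ E) (inf_le_right.trans (hEI.trans (by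
    rw [prod_le]
    rintro _ ⟨x, hx, rfl⟩ a -
    exact ⟨_, hga a ⟨x, hx⟩, rfl⟩)))
  refine ⟨⟨D ⊓ E, hD.inf hE, f, g, fun a x hx => hfu (hf _) fun y => ?_,
    fun a x hx => hgu (hg _) fun y => ?_, fun x y => ?_⟩, fun x y => hg x y⟩
  · change a * f ⟨x, hx⟩ * ((y : B) : A) = a * x * (p.g y : A)
    rw [mul_assoc, mul_assoc]
    exact congrArg (a * ·) (hf ⟨x, hx⟩ y)
  · change ((y : B) : A) * (g ⟨x, hx⟩ * a) = (p.f y : A) * (x * a)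
    rw [← mul_assoc, ← mul_assoc]
    exact congrArg (· * a) (hg ⟨x, hx⟩ y)
  -- Compatibility need only be checked for first arguments `a x` with `x ∈ p.dom`, where it is the
  -- defining property of `Gg`.
  · let N : Submodule Φ A := (LinearMap.eqLocus
      ((LinearMap.mulRight Φ (y : A)).comp (LinearMap.snd Φ A A))
      ((LinearMap.mulRight Φ (g y)).comp (LinearMap.fst Φ A A)) ⊓ Gf).map (LinearMap.fst Φ A A)
    have hN : prod ⊤ (p.dom.map (incl B)) ≤ N := by
      rw [prod_le]
      rintro a - _ ⟨x, hx, rfl⟩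
      refine ⟨_, ⟨?_, hfa a ⟨x, hx⟩⟩, rfl⟩
      change a * (p.f ⟨x, hx⟩ : A) * y = a * (x : A) * g y
      rw [mul_assoc, mul_assoc]
      exact congrArg (a * ·) (hg y ⟨x, hx⟩).symm
    obtain ⟨⟨x', z⟩, ⟨h1, h2⟩, h3⟩ := hN (hDI x.2.1)
    obtain rfl : x' = x := h3
    rw [hfu (hf x) h2]
    exact h1

end PeirceSystem

end Peirce

/-! ### The idempotents of a Peirce system and the diagonal of `Q_s(A)` -/

section Idempotents

variable {Φ : Type v} {A : Type u} [CommRing Φ] [NonUnitalRing A] [Module Φ A]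
  [IsScalarTower Φ A A] [SMulCommClass Φ A A] [IsSemiprime Φ A]
  {ι : Type*} [DecidableEq ι] {B : NonUnitalSubalgebra Φ A} {H : ι → Submodule Φ A}

/-- The elements `e i` of `Q_s(A)` act on each `H j` as the Kronecker delta. -/
def IsUnitFamily (H : ι → Submodule Φ A) (e : ι → Qs Φ A) : Prop :=
  ∀ i j, ∀ h ∈ H j, Qs.of Φ A h * e i = (if i = j then Qs.of Φ A h else 0) ∧
    e i * Qs.of Φ A h = if i = j then Qs.of Φ A h else 0

namespace PeirceSystem

theorem qs_eq_zero (P : PeirceSystem B H) {s : Qs Φ A}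
    (h : ∀ j, ∀ k ∈ H j, Qs.of Φ A k * s = 0) : s = 0 := by
  refine Qs.eq_zero_of_of_mul IsEssentialIdeal.top fun x _ => ?_
  refine P.mem_of_mul_mem (M := LinearMap.ker ((LinearMap.mulRight Φ s).comp
    (Qs.of Φ A : A →ₗ[Φ] Qs Φ A))) (fun a j k hk => ?_) x
  change Qs.of Φ A (a * k) * s = 0
  rw [map_mul, mul_assoc, h j k hk, mul_zero]

theorem exists_isUnitFamily (P : PeirceSystem B H) : ∃ e, IsUnitFamily H e := by
  suffices h : ∀ i, ∃ s : Qs Φ A, ∀ j, ∀ k ∈ H j,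
      Qs.of Φ A k * s = (if i = j then Qs.of Φ A k else 0) ∧
      s * Qs.of Φ A k = if i = j then Qs.of Φ A k else 0 by
    choose e he using h
    exact ⟨e, he⟩
  intro i
  let Gf : Submodule Φ (A × A) :=
    { carrier := {w | ∀ j, ∀ k ∈ H j, w.2 * k = if i = j then w.1 * k else 0}
      add_mem' := fun {w w'} h h' j k hk => by
        rw [Prod.snd_add, Prod.fst_add, add_mul, add_mul, h j k hk, h' j k hk]
        split_ifs <;> simp
      zero_mem' := fun j k hk => by simp
      smul_mem' := fun c w h j k hk => by
        rw [Prod.smul_snd, Prod.smul_fst, smul_mul_assoc, smul_mul_assoc, h j k hk]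
        split_ifs <;> simp }
  let Gg : Submodule Φ (A × A) :=
    { carrier := {w | ∀ j, ∀ k ∈ H j, k * w.2 = if i = j then k * w.1 else 0}
      add_mem' := fun {w w'} h h' j k hk => by
        rw [Prod.snd_add, Prod.fst_add, mul_add, mul_add, h j k hk, h' j k hk]
        split_ifs <;> simp
      zero_mem' := fun j k hk => by simp
      smul_mem' := fun c w h j k hk => by
        rw [Prod.smul_snd, Prod.smul_fst, mul_smul_comm, mul_smul_comm, h j k hk]
        split_ifs <;> simp }
  have hf0 : ∀ z, ((0 : A), z) ∈ Gf → z = 0 := fun z hz =>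
    P.eq_zero_of_mul_right fun j k hk => (hz j k hk).trans (by simp)
  have hg0 : ∀ z, ((0 : A), z) ∈ Gg → z = 0 := fun z hz =>
    P.eq_zero_of_mul_left fun j k hk => (hz j k hk).trans (by simp)
  have hfu : ∀ {x z w}, (x, z) ∈ Gf → (x, w) ∈ Gf → z = w := fun hz hw =>
    sub_eq_zero.1 (hf0 _ (by simpa using Gf.sub_mem hz hw))
  have hgu : ∀ {x z w}, (x, z) ∈ Gg → (x, w) ∈ Gg → z = w := fun hz hw =>
    sub_eq_zero.1 (hg0 _ (by simpa using Gg.sub_mem hz hw))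
  have hfa : ∀ a j, ∀ k ∈ H j, (a * k, if i = j then a * k else 0) ∈ Gf := by
    intro a j k hk l k' hk'
    change (if i = j then a * k else 0) * k' = if i = l then a * k * k' else 0
    by_cases hjl : j = l
    · subst hjl
      split_ifs <;> simp
    · have : k * k' = 0 := P.mul_eq_zero hjl hk hk'
      split_ifs <;> simp [mul_assoc, this]
  have hga : ∀ a j, ∀ k ∈ H j, (k * a, if i = j then k * a else 0) ∈ Gg := by
    intro a j k hk l k' hk'
    change k' * (if i = j then k * a else 0) = if i = l then k' * (k * a) else 0
    by_cases hjl : j = l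
    · subst hjl
      split_ifs <;> simp
    · have : k' * k = 0 := P.mul_eq_zero (Ne.symm hjl) hk' hk
      split_ifs <;> simp [← mul_assoc, this]
  -- The domain is all of `A`, since the products `a k` with `k ∈ H j` span it.
  obtain ⟨f, hf⟩ := exists_linearMap_of_graph Gf hf0 ⊤ fun x _ =>
    P.mem_of_mul_mem (M := Gf.map (LinearMap.fst Φ A A))
      (fun a j k hk => ⟨_, hfa a j k hk, rfl⟩) x
  obtain ⟨g, hg⟩ := exists_linearMap_of_graph Gg hg0 ⊤ fun x _ =>
    P.mem_of_mul_mem' (M := Gg.map (LinearMap.fst Φ A A))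
      (fun a j k hk => ⟨_, hga a j k hk, rfl⟩) x
  have hB : ∀ j, ∀ k ∈ H j,
      (k, if i = j then k else 0) ∈ Gf ∧ (k, if i = j then k else 0) ∈ Gg := by
    intro j k hk
    refine ⟨fun l k' hk' => ?_, fun l k' hk' => ?_⟩
    · by_cases hjl : j = l
      · subst hjl
        dsimp only
        split_ifs <;> simp
      · have : k * k' = 0 := P.mul_eq_zero hjl hk hk'
        dsimp only
        split_ifs <;> simp [this]
    · by_cases hjl : j = l
      · subst hjl
        dsimp only
        split_ifs <;> simp
      · have : k' * k = 0 := P.mul_eq_zero (Ne.symm hjl) hk' hk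
        dsimp only
        split_ifs <;> simp [this]
  let p : CompatiblePair Φ A :=
    { dom := ⊤
      essential := IsEssentialIdeal.top
      f := f
      g := g
      f_mul := fun a x hx => hfu (hf _) fun j k hk => by
        have := hf ⟨x, hx⟩ j k hk
        dsimp only at this ⊢
        rw [mul_assoc, this]
        split_ifs <;> simp [mul_assoc]
      g_mul := fun a x hx => hgu (hg _) fun j k hk => by
        have := hg ⟨x, hx⟩ j k hk
        dsimp only at this ⊢
        rw [← mul_assoc, this]
        split_ifs <;> simp [mul_assoc]
      compat := fun x y => by
        have key : (y : A) ∈ LinearMap.eqLocus (LinearMap.mulLeft Φ (f x))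
            ((LinearMap.mulLeft Φ (x : A)).comp (g.comp
              (LinearMap.id.codRestrict ⊤ fun _ => Submodule.mem_top))) := by
          refine P.mem_of_mul_mem' (fun a j k hk => ?_) (y : A)
          change f x * (k * a) = x * g ⟨k * a, _⟩
          rw [hgu (hg ⟨k * a, _⟩) (hga a j k hk), ← mul_assoc, hf x j k hk]
          split_ifs <;> simp [mul_assoc]
        exact key }
  refine ⟨Qs.mk p, fun j k hk => ?_⟩
  obtain ⟨h1, h2⟩ := hB j k hk
  have hf' : f ⟨k, Submodule.mem_top⟩ = _ := hfu (hf ⟨k, _⟩) h1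
  have hg' : g ⟨k, Submodule.mem_top⟩ = _ := hgu (hg ⟨k, _⟩) h2
  refine ⟨(Qs.of_mul_mk p ⟨k, Submodule.mem_top⟩).trans ?_,
    (Qs.mk_mul_of p ⟨k, Submodule.mem_top⟩).trans ?_⟩
  · change Qs.of Φ A (f _) = _
    rw [hf']
    split_ifs <;> simp
  · change Qs.of Φ A (g _) = _
    rw [hg']
    split_ifs <;> simp

variable [Fintype ι]

theorem completeOrthogonalIdempotents (P : PeirceSystem B H) {e : ι → Qs Φ A}
    (he : IsUnitFamily H e) : CompleteOrthogonalIdempotents e where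
  idem i := sub_eq_zero.1 <| P.qs_eq_zero fun j k hk => by
    rw [mul_sub, ← mul_assoc, (he i j k hk).1]
    split_ifs with h
    · rw [(he i j k hk).1, if_pos h, sub_self]
    · simp
  ortho i i' hi := P.qs_eq_zero fun j k hk => by
    rw [← mul_assoc, (he i j k hk).1]
    split_ifs with h
    · rw [(he i' j k hk).1, if_neg fun h' => hi (h.trans h'.symm)]
    · simp
  complete := sub_eq_zero.1 <| P.qs_eq_zero fun j k hk => by
    rw [mul_sub, Finset.mul_sum, Finset.sum_congr rfl fun i _ => (he i j k hk).1]
    simp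

/-- Expand `a` along `A = ∑ A H_l` and `A = ∑ H_m A`: the idempotents keep only the terms with `l =
j` and `m = i`. -/
theorem map_sandwich (P : PeirceSystem B H) {e : ι → Qs Φ A} (he : IsUnitFamily H e) (i j : ι) :
    (prod (prod (H i) ⊤) (H j)).map (Qs.of Φ A : A →ₗ[Φ] Qs Φ A) =
      (LinearMap.range (Qs.of Φ A : A →ₗ[Φ] Qs Φ A)).map (sandwich (e i) (e j)) := by
  apply le_antisymm
  · rw [Submodule.map_le_iff_le_comap, prod_le]
    intro x hx k hk
    have hx' : prod (H i) ⊤ ≤ LinearMap.eqLocus ((LinearMap.mulLeft Φ (e i)).comp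
        (Qs.of Φ A : A →ₗ[Φ] Qs Φ A)) (Qs.of Φ A : A →ₗ[Φ] Qs Φ A) := by
      rw [prod_le]
      intro h hh a _
      change e i * Qs.of Φ A (h * a) = Qs.of Φ A (h * a)
      rw [map_mul, ← mul_assoc, (he i i h hh).2, if_pos rfl]
    have hx : e i * Qs.of Φ A x = Qs.of Φ A x := hx' hx
    refine ⟨Qs.of Φ A (x * k), ⟨_, rfl⟩, ?_⟩
    change e i * (Qs.of Φ A (x * k) * e j) = Qs.of Φ A (x * k)
    rw [map_mul, mul_assoc, (he j j k hk).1, if_pos rfl, ← mul_assoc, hx]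
  · rintro _ ⟨_, ⟨a, rfl⟩, rfl⟩
    let T := (prod (prod (H i) ⊤) (H j)).map (Qs.of Φ A : A →ₗ[Φ] Qs Φ A)
    change Qs.of Φ A a ∈ T.comap (sandwich (e i) (e j))
    refine P.mem_of_mul_mem (M := Submodule.comap ((sandwich (e i) (e j)).comp
      (Qs.of Φ A : A →ₗ[Φ] Qs Φ A)) T) (fun a l k hk => ?_) a
    change e i * (Qs.of Φ A (a * k) * e j) ∈ T
    rw [map_mul, mul_assoc, (he j l k hk).1]
    split_ifs with h
    · subst h
      refine P.mem_of_mul_mem' (M := Submodule.comap ((sandwich (e i) (Qs.of Φ A k)).comp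
        (Qs.of Φ A : A →ₗ[Φ] Qs Φ A)) T) (fun a l m hm => ?_) a
      change e i * (Qs.of Φ A (m * a) * Qs.of Φ A k) ∈ T
      rw [map_mul, ← mul_assoc, ← mul_assoc, (he i l m hm).2]
      split_ifs with h
      · subst h
        refine ⟨m * a * k, mul_mem_prod (mul_mem_prod hm Submodule.mem_top) hk, ?_⟩
        exact (map_mul (Qs.of Φ A) _ _).trans (congrArg (· * _) (map_mul (Qs.of Φ A) _ _))
      · simp
    · simp

/-- By `le_sandwich`, every `k ∈ H j` has the form `e j * s * e j`, so orthogonality settles both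
products. -/
theorem isUnitFamily (P : PeirceSystem B H) {e : ι → Qs Φ A} (he : OrthogonalIdempotents e)
    (h : ∀ i j, (prod (prod (H i) ⊤) (H j)).map (Qs.of Φ A : A →ₗ[Φ] Qs Φ A) =
      (LinearMap.range (Qs.of Φ A : A →ₗ[Φ] Qs Φ A)).map (sandwich (e i) (e j))) :
    IsUnitFamily H e := by
  intro i j k hk
  obtain ⟨s, -, hs⟩ := (h j j).le ⟨k, P.le_sandwich j hk, rfl⟩
  have hs : e j * (s * e j) = Qs.of Φ A k := hs
  rw [← hs]
  by_cases hij : i = j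
  · subst hij
    simp only [if_true]
    exact ⟨by rw [mul_assoc, mul_assoc, he.idem i], by rw [← mul_assoc, he.idem i]⟩
  · simp only [if_neg hij]
    exact ⟨by rw [mul_assoc, mul_assoc, he.ortho (Ne.symm hij), mul_zero, mul_zero],
      by rw [← mul_assoc, he.ortho hij, zero_mul]⟩

variable {e : ι → Qs Φ A}

theorem of_mul_comm (P : PeirceSystem B H) (he : IsUnitFamily H e) (i : ι) {b : A} (hb : b ∈ B) :
    Qs.of Φ A b * e i = e i * Qs.of Φ A b := by
  have : ⨆ j, H j ≤ LinearMap.eqLocus ((LinearMap.mulRight Φ (e i)).comp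
      (Qs.of Φ A : A →ₗ[Φ] Qs Φ A)) ((LinearMap.mulLeft Φ (e i)).comp
      (Qs.of Φ A : A →ₗ[Φ] Qs Φ A)) :=
    iSup_le fun j k hk => (he i j k hk).1.trans (he i j k hk).2.symm
  exact this (P.le_iSup hb)

theorem of_eq_sum (P : PeirceSystem B H) (he : IsUnitFamily H e) {b : A} (hb : b ∈ B) :
    ∑ i, e i * Qs.of Φ A b * e i = Qs.of Φ A b := by
  have hc := P.completeOrthogonalIdempotents he
  have h : ∀ i, e i * Qs.of Φ A b * e i = e i * Qs.of Φ A b := fun i => by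
    rw [mul_assoc, P.of_mul_comm he i hb, ← mul_assoc, hc.idem i]
  rw [Finset.sum_congr rfl fun i _ => h i, ← Finset.sum_mul, hc.complete, one_mul]

/-- Together with `of_eq_sum`: the elements of `A` that are diagonal in `Q_s(A)` are exactly those
of `B`. Each `e i * c * e i` comes from `H_i A H_i ⊆ B`. -/
theorem mem_of_sum_eq (P : PeirceSystem B H) (he : IsUnitFamily H e) {c : A}
    (hc : ∑ i, e i * Qs.of Φ A c * e i = Qs.of Φ A c) : c ∈ B := by
  have h : ∀ i, ∃ d ∈ prod (prod (H i) ⊤) (H i), Qs.of Φ A d = e i * Qs.of Φ A c * e i := by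
    intro i
    have hmem : e i * Qs.of Φ A c * e i ∈
        (LinearMap.range (Qs.of Φ A : A →ₗ[Φ] Qs Φ A)).map (sandwich (e i) (e i)) :=
      ⟨_, ⟨c, rfl⟩, (mul_assoc _ _ _).symm⟩
    exact (P.map_sandwich he i i).ge hmem
  choose d hd hd' using h
  have hle : ∀ i, prod (prod (H i) ⊤) (H i) ≤ B.toSubmodule := by
    intro i
    rw [prod_le]
    intro x hx k hk
    have : prod (H i) ⊤ ≤ B.toSubmodule.comap (LinearMap.mulRight Φ k) :=
      prod_le.2 fun l hl a _ => P.corner a hl hk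
    exact this hx
  have : c = ∑ i, d i := Qs.of_injective (by rw [map_sum, ← hc]; simp_rw [hd'])
  rw [this]
  exact sum_mem fun i _ => hle i (hd i)

/-- The diagonal part of `Q_s(A)` is an algebra of symmetric quotients of `B`. -/
theorem isSymmetricQuotient (P : PeirceSystem B H) (he : IsUnitFamily H e) [IsSemiprime Φ B]
    {Q : Type*} [Ring Q] [Algebra Φ Q] (ι' : B →ₙₐ[Φ] Q) (j : Q →ₐ[Φ] Qs Φ A)
    (hj : Function.Injective j) (hrange : ∀ s, (∃ q, j q = s) ↔ ∑ i, e i * s * e i = s)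
    (hι : ∀ b : B, j (ι' b) = Qs.of Φ A (b : A)) : IsSymmetricQuotient Φ B Q ι' where
  injective b c h := Subtype.ext (Qs.of_injective (Φ := Φ) (by rw [← hι, ← hι, h]))
  exists_ideal q := by
    obtain ⟨p, hp⟩ := Qs.exists_mk (j q)
    refine ⟨p.dom.comap (incl B), P.isEssentialIdeal_comap p.essential, fun x hx => ⟨?_, ?_⟩⟩
    · have h : j (ι' x * q) = Qs.of Φ A (p.f ⟨x, hx⟩) := by
        rw [map_mul, hι, ← hp]
        exact Qs.of_mul_mk p ⟨x, hx⟩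
      have hB := P.mem_of_sum_eq he ((hrange _).1 ⟨_, h⟩)
      exact ⟨⟨_, hB⟩, hj (by rw [h, hι])⟩
    · have h : j (q * ι' x) = Qs.of Φ A (p.g ⟨x, hx⟩) := by
        rw [map_mul, hι, ← hp]
        exact Qs.mk_mul_of p ⟨x, hx⟩
      have hB := P.mem_of_sum_eq he ((hrange _).1 ⟨_, h⟩)
      exact ⟨⟨_, hB⟩, hj (by rw [h, hι])⟩
  eq_zero I q hI h := by
    obtain ⟨p, hp⟩ := Qs.exists_mk (j q)
    refine hj ((Qs.eq_zero_of_mul_of p.essential fun a ha => ?_).trans (map_zero j).symm)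
    -- The element `q a` lies in `A` and is annihilated on the left by an essential ideal of `B`.
    have h0 : p.g ⟨a, ha⟩ = 0 := P.eq_zero_of_ideal_mul hI fun x hx => ?_
    · rw [← hp, Qs.mk_mul_of p ⟨a, ha⟩, h0, map_zero]
    apply Qs.of_injective (Φ := Φ)
    rw [map_mul, ← Qs.mk_mul_of, hp, ← mul_assoc, ← hι, ← map_mul, h x hx, map_zero, zero_mul,
      map_zero]
  exists_eq p := by
    obtain ⟨r, hr⟩ := P.exists_extension p
    have hc := P.completeOrthogonalIdempotents he
    have hs : ∀ x : p.dom, Qs.of Φ A ((x : B) : A) * Qs.mk r = Qs.of Φ A (p.f x : A) := by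
      intro x
      rw [← sub_eq_zero]
      refine Qs.eq_zero_of_mul_of r.essential fun a ha => ?_
      rw [sub_mul, mul_assoc, Qs.mk_mul_of r ⟨a, ha⟩, ← map_mul, ← map_mul, hr, sub_self]
    -- The extension `r` is replaced by its diagonal part. Elements of `B` commute with the `e i`,
    -- so this does not change how `p.dom` multiplies into it.
    obtain ⟨q, hq⟩ := (hrange (∑ i, e i * Qs.mk r * e i)).2 (by
      refine Finset.sum_congr rfl fun i _ => ?_
      rw [Finset.mul_sum, Finset.sum_eq_single i (fun l _ hl => ?_) (by simp)]
      · rw [← mul_assoc, ← mul_assoc, hc.idem i, mul_assoc, hc.idem i]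
      · rw [mul_assoc, ← mul_assoc, hc.ortho (Ne.symm hl), zero_mul])
    refine ⟨q, fun x => hj ?_⟩
    rw [map_mul, hι, hι, hq, ← P.of_eq_sum he (p.f x).2, Finset.mul_sum]
    refine Finset.sum_congr rfl fun i _ => ?_
    rw [← mul_assoc, ← mul_assoc, P.of_mul_comm he i x.1.2, mul_assoc (e i), hs]

end PeirceSystem

end Idempotents

/-! ### The grading defined by a complete system of orthogonal idempotents -/

section PeirceGrading

variable {Φ : Type v} [CommRing Φ] {Q : Type*} [Ring Q] [Algebra Φ Q] {n : ℕ}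
  {e : Fin (n + 1) → Q}

theorem eq_sum_sandwich (he : CompleteOrthogonalIdempotents e) (q : Q) :
    ∑ i, ∑ j, e i * q * e j = q := by
  simp_rw [← Finset.mul_sum, ← Finset.sum_mul, he.complete, one_mul, mul_one]

theorem sandwich_mem_idempotentGrading (i j : Fin (n + 1)) (q : Q) :
    e i * q * e j ∈ idempotentGrading (Φ := Φ) e (((i : ℕ) : ℤ) - ((j : ℕ) : ℤ)) :=
  Submodule.mem_iSup_of_mem i (Submodule.mem_iSup_of_mem j (Submodule.mem_iSup_of_mem rfl
    ⟨q, (mul_assoc _ _ _).symm⟩))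

/-- Turns membership in a sum into vanishing of the other corners, from which independence and
multiplicativity can be read off. -/
theorem mem_idempotentGrading (he : CompleteOrthogonalIdempotents e) {k : ℤ} {q : Q} :
    q ∈ idempotentGrading (Φ := Φ) e k ↔
      ∀ i j : Fin (n + 1), ((i : ℕ) : ℤ) - ((j : ℕ) : ℤ) ≠ k → e i * q * e j = 0 := by
  constructor
  · intro hq i j hij
    have : idempotentGrading (Φ := Φ) e k ≤ LinearMap.ker (sandwich (Φ := Φ) (e i) (e j)) := by
      refine iSup_le fun a => iSup_le fun b => iSup_le fun hab => ?_
      rintro _ ⟨s, rfl⟩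
      change e i * (e a * (s * e b) * e j) = 0
      by_cases hia : i = a
      · have hbj : b ≠ j := by
          rintro rfl
          exact hij (hia ▸ hab)
        rw [mul_assoc, mul_assoc, he.ortho hbj, mul_zero, mul_zero, mul_zero]
      · rw [← mul_assoc, ← mul_assoc, he.ortho hia, zero_mul, zero_mul]
    exact (mul_assoc _ _ _).trans (this hq)
  · intro h
    rw [← eq_sum_sandwich he q]
    refine sum_mem fun i _ => sum_mem fun j _ => ?_
    by_cases hij : ((i : ℕ) : ℤ) - ((j : ℕ) : ℤ) = k
    · exact hij ▸ sandwich_mem_idempotentGrading i j q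
    · rw [h i j hij]
      exact zero_mem _

theorem idempotentGrading_isInternal (he : CompleteOrthogonalIdempotents e) :
    DirectSum.IsInternal (idempotentGrading (Φ := Φ) e) := by
  rw [DirectSum.isInternal_submodule_iff_iSupIndep_and_iSup_eq_top]
  refine ⟨fun k => ?_, ?_⟩
  · rw [Submodule.disjoint_def]
    intro q hq hq'
    rw [← eq_sum_sandwich he q]
    refine Finset.sum_eq_zero fun i _ => Finset.sum_eq_zero fun j _ => ?_
    by_cases hij : ((i : ℕ) : ℤ) - ((j : ℕ) : ℤ) = k
    · have : ⨆ l, ⨆ (_ : l ≠ k), idempotentGrading (Φ := Φ) e l ≤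
          LinearMap.ker (sandwich (Φ := Φ) (e i) (e j)) := by
        refine iSup_le fun l => iSup_le fun hl s hs => ?_
        exact (mul_assoc _ _ _).symm.trans
          ((mem_idempotentGrading he).1 hs i j (hij ▸ Ne.symm hl))
      exact (mul_assoc _ _ _).trans (this hq')
    · exact (mem_idempotentGrading he).1 hq i j hij
  · rw [eq_top_iff]
    intro q _
    rw [← eq_sum_sandwich he q]
    refine sum_mem fun i _ => sum_mem fun j _ => ?_
    exact le_iSup (idempotentGrading (Φ := Φ) e) (((i : ℕ) : ℤ) - ((j : ℕ) : ℤ))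
      (sandwich_mem_idempotentGrading i j q)

/-- The Peirce grading determined by a complete system of orthogonal idempotents. -/
@[reducible]
noncomputable def idempotentGradedAlgebra (he : CompleteOrthogonalIdempotents e) :
    GradedAlgebra (idempotentGrading (Φ := Φ) e) where
  __ := (idempotentGrading_isInternal (Φ := Φ) he).chooseDecomposition
  one_mem := (mem_idempotentGrading he).2 fun i j hij => by
    rw [mul_one, he.ortho]
    rintro rfl
    exact hij (sub_self _)
  mul_mem k l p q hp hq := (mem_idempotentGrading he).2 fun i j hij => by
    rw [← one_mul q, ← he.complete, Finset.sum_mul, Finset.mul_sum, Finset.mul_sum,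
      Finset.sum_mul]
    refine Finset.sum_eq_zero fun m _ => ?_
    have h : e i * (p * (e m * q)) * e j = e i * p * e m * (e m * q * e j) := by
      nth_rw 1 [← he.idem m]
      simp only [mul_assoc]
    rw [h]
    by_cases him : ((i : ℕ) : ℤ) - ((m : ℕ) : ℤ) = k
    · rw [(mem_idempotentGrading he).1 hq m j (by omega), mul_zero]
    · rw [(mem_idempotentGrading he).1 hp i m him, zero_mul]

theorem mem_idempotentGrading_zero (he : CompleteOrthogonalIdempotents e) {q : Q} :
    q ∈ idempotentGrading (Φ := Φ) e 0 ↔ ∑ i, e i * q * e i = q := by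
  rw [mem_idempotentGrading he]
  constructor
  · intro h
    conv_rhs => rw [← eq_sum_sandwich he q]
    refine Finset.sum_congr rfl fun i _ => (Finset.sum_eq_single (f := fun j => e i * q * e j) i
      (fun j _ hj => ?_) fun h => absurd (Finset.mem_univ i) h).symm
    refine h i j fun h0 => hj (Fin.ext ?_)
    omega
  · intro h i j hij
    rw [← h, Finset.mul_sum, Finset.sum_mul]
    refine Finset.sum_eq_zero fun l _ => ?_
    by_cases hil : i = l
    · have hlj : l ≠ j := by
        rintro rfl
        exact hij (by rw [hil, sub_self])
      rw [mul_assoc, mul_assoc, he.ortho hlj, mul_zero, mul_zero]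
    · rw [← mul_assoc, ← mul_assoc, he.ortho hil, zero_mul, zero_mul, zero_mul]

end PeirceGrading

/-! ### The graded algebra `A` yields a Peirce system -/

section Gradings

variable {Φ : Type v} {A : Type u} [CommRing Φ] [NonUnitalRing A] [Module Φ A]
  [IsScalarTower Φ A A] [SMulCommClass Φ A A]

theorem exists_projection {M : Type*} [AddCommGroup M] [Module Φ M] {𝒜 : ℤ → Submodule Φ M}
    (h : DirectSum.IsInternal 𝒜) (k : ℤ) :
    ∃ π : M →ₗ[Φ] M, (∀ x ∈ 𝒜 k, π x = x) ∧ ∀ l ≠ k, ∀ x ∈ 𝒜 l, π x = 0 := by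
  let := h.chooseDecomposition
  refine ⟨(𝒜 k).subtype.comp ((DirectSum.component Φ ℤ (fun i => 𝒜 i) k).comp
    (DirectSum.decomposeLinearEquiv 𝒜).toLinearMap), fun x hx => ?_, fun l hl x hx => ?_⟩
  · exact DirectSum.decompose_of_mem_same 𝒜 hx
  · exact DirectSum.decompose_of_mem_ne 𝒜 hx hl

theorem peirceH_le {n : ℕ} {𝒜 : ℤ → Submodule Φ A} {i : Fin (n + 1)} {M : Submodule Φ A}
    (h : ∀ x ∈ 𝒜 (i : ℕ), ∀ y ∈ 𝒜 (-n), ∀ z ∈ 𝒜 (n - (i : ℕ)), x * y * z ∈ M) :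
    peirceH n 𝒜 i ≤ M := by
  refine prod_le.2 fun w hw z hz => ?_
  have : prod (𝒜 (i : ℕ)) (𝒜 (-n)) ≤ M.comap (LinearMap.mulRight Φ z) :=
    prod_le.2 fun x hx y hy => h x hx y hy z hz
  exact this hw

theorem prod_prod_le {M N P R : Submodule Φ A} :
    prod (prod M N) P ≤ R ↔ ∀ x ∈ M, ∀ y ∈ N, ∀ z ∈ P, x * y * z ∈ R := by
  refine ⟨fun h x hx y hy z hz => h (mul_mem_prod (mul_mem_prod hx hy) hz), fun h => ?_⟩
  refine prod_le.2 fun w hw z hz => ?_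
  have : prod M N ≤ R.comap (LinearMap.mulRight Φ z) :=
    prod_le.2 fun x hx y hy => h x hx y hy z hz
  exact this hw

variable {n : ℕ} {𝒜 : ℤ → Submodule Φ A}

theorem mul_mul_mem_graded [SetLike.GradedMul 𝒜] {i j k l : ℤ} (h : i + j + k = l) {x y z : A}
    (hx : x ∈ 𝒜 i) (hy : y ∈ 𝒜 j) (hz : z ∈ 𝒜 k) : x * y * z ∈ 𝒜 l :=
  h ▸ SetLike.mul_mem_graded (SetLike.mul_mem_graded hx hy) hz

theorem mul_mem_graded' [SetLike.GradedMul 𝒜] {i j l : ℤ} (h : i + j = l) {x y : A}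
    (hx : x ∈ 𝒜 i) (hy : y ∈ 𝒜 j) : x * y ∈ 𝒜 l :=
  h ▸ SetLike.mul_mem_graded hx hy

theorem eq_zero_of_support (hsupport : ∀ k : ℤ, (n : ℤ) < |k| → 𝒜 k = ⊥) {k : ℤ}
    (hk : (n : ℤ) < |k|) {x : A} (hx : x ∈ 𝒜 k) : x = 0 := by
  rwa [hsupport k hk, Submodule.mem_bot] at hx

theorem peirceH_le_zero [SetLike.GradedMul 𝒜] (i : Fin (n + 1)) : peirceH n 𝒜 i ≤ 𝒜 0 :=
  peirceH_le fun _ hx _ hy _ hz => mul_mul_mem_graded (by ring) hx hy hz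

theorem mul_mem_peirceH [SetLike.GradedMul 𝒜] {i : Fin (n + 1)} {b x : A} (hb : b ∈ 𝒜 0)
    (hx : x ∈ peirceH n 𝒜 i) : b * x ∈ peirceH n 𝒜 i := by
  have : peirceH n 𝒜 i ≤ (peirceH n 𝒜 i).comap (LinearMap.mulLeft Φ b) := by
    refine peirceH_le fun x hx y hy z hz => ?_
    simp only [Submodule.mem_comap, LinearMap.mulLeft_apply, ← mul_assoc]
    exact mul_mem_prod (mul_mem_prod (mul_mem_graded' (zero_add _) hb hx) hy) hz
  exact this hx

theorem peirceH_mul_mem [SetLike.GradedMul 𝒜] {i : Fin (n + 1)} {b x : A} (hb : b ∈ 𝒜 0)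
    (hx : x ∈ peirceH n 𝒜 i) : x * b ∈ peirceH n 𝒜 i := by
  have : peirceH n 𝒜 i ≤ (peirceH n 𝒜 i).comap (LinearMap.mulRight Φ b) := by
    refine peirceH_le fun x hx y hy z hz => ?_
    simp only [Submodule.mem_comap, LinearMap.mulRight_apply, mul_assoc _ z b]
    exact mul_mem_prod (mul_mem_prod hx hy) (mul_mem_graded' (add_zero _) hz hb)
  exact this hx

theorem peirceH_mul_peirceH [SetLike.GradedMul 𝒜]
    (hsupport : ∀ k : ℤ, (n : ℤ) < |k| → 𝒜 k = ⊥) {i j : Fin (n + 1)} (hij : i ≠ j) {x y : A}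
    (hx : x ∈ peirceH n 𝒜 i) (hy : y ∈ peirceH n 𝒜 j) : x * y = 0 := by
  have : peirceH n 𝒜 i ≤ LinearMap.ker (LinearMap.mulRight Φ y) := by
    refine peirceH_le fun p hp q hq r hr => ?_
    have : peirceH n 𝒜 j ≤ LinearMap.ker (LinearMap.mulLeft Φ (p * q * r)) := by
      refine peirceH_le fun p' hp' q' hq' r' hr' => ?_
      change p * q * r * (p' * q' * r') = 0
      have hm := mul_mem_graded' rfl hr hp'
      -- For `i < j` the factor `r p'` has degree `n - i + j > n`; for `i > j` the factor `q r p'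
      -- q'` has degree `-n - i + j < -n`.
      rcases lt_or_gt_of_ne hij with h | h
      · have h0 := eq_zero_of_support hsupport (lt_abs.2 (Or.inl (by omega))) hm
        rw [show p * q * r * (p' * q' * r') = p * q * (r * p') * q' * r' by
          simp only [mul_assoc], h0]
        simp
      · have h0 := eq_zero_of_support hsupport (lt_abs.2 (Or.inr (by omega)))
          (mul_mul_mem_graded rfl hq hm hq')
        rw [show p * q * r * (p' * q' * r') = p * (q * (r * p') * q') * r' by
          simp only [mul_assoc], h0]
        simp
    exact this hy
  exact this hx

theorem peirceH_mul_mul_peirceH [SetLike.GradedMul 𝒜]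
    (hsupport : ∀ k : ℤ, (n : ℤ) < |k| → 𝒜 k = ⊥) {i j : Fin (n + 1)} {k : ℤ}
    (hk : ((i : ℕ) : ℤ) - ((j : ℕ) : ℤ) ≠ k) {x a y : A}
    (hx : x ∈ peirceH n 𝒜 i) (ha : a ∈ 𝒜 k) (hy : y ∈ peirceH n 𝒜 j) : x * a * y = 0 := by
  have : peirceH n 𝒜 i ≤ LinearMap.ker (LinearMap.mulRight Φ (a * y)) := by
    refine peirceH_le fun p hp q hq r hr => ?_
    have : peirceH n 𝒜 j ≤ LinearMap.ker (LinearMap.mulLeft Φ (p * q * r * a)) := by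
      refine peirceH_le fun p' hp' q' hq' r' hr' => ?_
      change p * q * r * a * (p' * q' * r') = 0
      have hm := mul_mul_mem_graded rfl hr ha hp'
      rcases lt_or_gt_of_ne hk with h | h
      · have h0 := eq_zero_of_support hsupport (lt_abs.2 (Or.inl (by omega))) hm
        rw [show p * q * r * a * (p' * q' * r') = p * q * (r * a * p') * q' * r' by
          simp only [mul_assoc], h0]
        simp
      · have h0 := eq_zero_of_support hsupport (lt_abs.2 (Or.inr (by omega)))
          (mul_mul_mem_graded rfl hq hm hq')
        rw [show p * q * r * a * (p' * q' * r') = p * (q * (r * a * p') * q') * r' by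
          simp only [mul_assoc], h0]
        simp
    have h0 : p * q * r * a * y = 0 := this hy
    exact (mul_assoc _ _ _).symm.trans h0
  exact (mul_assoc _ _ _).trans (this hx)

/-- The degree `k` part of `A = A_0 A A_0`. -/
theorem le_zero_mul_mul_zero [SetLike.GradedMul 𝒜] (hgrading : DirectSum.IsInternal 𝒜)
    (hzero : prod (prod (𝒜 0) ⊤) (𝒜 0) = ⊤) (k : ℤ) :
    𝒜 k ≤ prod (prod (𝒜 0) (𝒜 k)) (𝒜 0) := by
  obtain ⟨π, h1, h2⟩ := exists_projection hgrading k
  have key : prod (prod (𝒜 0) ⊤) (𝒜 0) ≤ (prod (prod (𝒜 0) (𝒜 k)) (𝒜 0)).comap π := by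
    refine prod_prod_le.2 fun b hb x _ c hc => ?_
    have : ⨆ l, 𝒜 l ≤ ((prod (prod (𝒜 0) (𝒜 k)) (𝒜 0)).comap π).comap
        ((LinearMap.mulRight Φ c).comp (LinearMap.mulLeft Φ b)) := by
      refine iSup_le fun l y hy => ?_
      change π (b * y * c) ∈ prod (prod (𝒜 0) (𝒜 k)) (𝒜 0)
      have hm : b * y * c ∈ 𝒜 l := mul_mul_mem_graded (by ring) hb hy hc
      by_cases hl : l = k
      · subst hl
        rw [h1 _ hm]
        exact mul_mem_prod (mul_mem_prod hb hy) hc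
      · rw [h2 l hl _ hm]
        exact zero_mem _
    exact this (hgrading.submodule_iSup_eq_top.ge Submodule.mem_top)
  intro x hx
  rw [← h1 x hx]
  exact key (hzero.ge Submodule.mem_top)

/-- The `x` with `A x A ⊆ A A_{-n} A` form an ideal containing `A_{-n}`, so `A A A ⊆ A A_{-n} A`;
and `A = A_0 A A_0` gives `A = A A A`. -/
theorem prod_prod_neg_eq_top (hgen : idealSpan (Φ := Φ) (𝒜 (-n) : Set A) = ⊤)
    (hzero : prod (prod (𝒜 0) ⊤) (𝒜 0) = ⊤) : prod (prod ⊤ (𝒜 (-n))) ⊤ = ⊤ := by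
  let J : Submodule Φ A :=
    { carrier := {x | ∀ a b, a * x * b ∈ prod (prod ⊤ (𝒜 (-n))) ⊤}
      add_mem' := fun hx hy a b => by
        rw [mul_add, add_mul]
        exact add_mem (hx a b) (hy a b)
      zero_mem' := fun a b => by
        rw [mul_zero, zero_mul]
        exact zero_mem _
      smul_mem' := fun c x hx a b => by
        rw [mul_smul_comm, smul_mul_assoc]
        exact Submodule.smul_mem _ c (hx a b) }
  have hJ : idealSpan (Φ := Φ) (𝒜 (-n) : Set A) ≤ J := sInf_le
    ⟨fun c x hx => ⟨fun a b => by rw [← mul_assoc]; exact hx (a * c) b,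
      fun a b => by rw [← mul_assoc, mul_assoc]; exact hx a (c * b)⟩,
      fun x hx a b => mul_mem_prod (mul_mem_prod Submodule.mem_top hx) Submodule.mem_top⟩
  refine eq_top_iff.2 (hzero.ge.trans (prod_prod_le.2 ?_))
  exact fun a _ x _ b _ => hJ (hgen.ge Submodule.mem_top) a b

theorem zero_le_iSup_peirceH [SetLike.GradedMul 𝒜] (hgrading : DirectSum.IsInternal 𝒜)
    (hsupport : ∀ k : ℤ, (n : ℤ) < |k| → 𝒜 k = ⊥)
    (hneg : prod (prod ⊤ (𝒜 (-n))) ⊤ = ⊤) : 𝒜 0 ≤ ⨆ i, peirceH n 𝒜 i := by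
  obtain ⟨π, h1, h2⟩ := exists_projection hgrading 0
  have key : prod (prod ⊤ (𝒜 (-n))) ⊤ ≤ (⨆ i, peirceH n 𝒜 i).comap π := by
    refine prod_prod_le.2 fun x _ y hy z _ => ?_
    have hx : ⨆ k, 𝒜 k ≤ ((⨆ i, peirceH n 𝒜 i).comap π).comap (LinearMap.mulRight Φ (y * z)) := by
      refine iSup_le fun k x hx => ?_
      have hz : ⨆ l, 𝒜 l ≤ ((⨆ i, peirceH n 𝒜 i).comap π).comap (LinearMap.mulLeft Φ (x * y)) := by
        refine iSup_le fun l z hz => ?_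
        change π (x * y * z) ∈ ⨆ i, peirceH n 𝒜 i
        have hm := mul_mul_mem_graded rfl hx hy hz
        -- In degree `0` one has `l = n - k`. For `k > n` the factor `x` vanishes and for `k < 0`
        -- the product `x y` does, so only `0 ≤ k ≤ n` contributes.
        by_cases hl : k + -n + l = 0
        · rw [h1 _ (hl ▸ hm)]
          by_cases hk : 0 ≤ k
          · by_cases hkn : k ≤ n
            · obtain ⟨m, rfl⟩ := Int.eq_ofNat_of_zero_le hk
              refine Submodule.mem_iSup_of_mem ⟨m, by omega⟩
                (mul_mem_prod (mul_mem_prod hx hy) ?_)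
              rwa [show (n : ℤ) - (m : ℕ) = l by omega]
            · rw [eq_zero_of_support hsupport (lt_abs.2 (Or.inl (by omega))) hx, zero_mul,
                zero_mul]
              exact zero_mem _
          · rw [eq_zero_of_support hsupport (lt_abs.2 (Or.inr (by omega)))
              (mul_mem_graded' rfl hx hy), zero_mul]
            exact zero_mem _
        · rw [h2 _ hl _ hm]
          exact zero_mem _
      have := hz (hgrading.submodule_iSup_eq_top.ge (Submodule.mem_top (x := z)))
      change π (x * (y * z)) ∈ ⨆ i, peirceH n 𝒜 i
      rw [← mul_assoc]
      exact this
    have := hx (hgrading.submodule_iSup_eq_top.ge (Submodule.mem_top (x := x)))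
    change π (x * (y * z)) ∈ ⨆ i, peirceH n 𝒜 i at this
    rw [← mul_assoc] at this
    exact this
  intro x hx
  rw [← h1 x hx]
  exact key (hneg.ge Submodule.mem_top)

/-- As `A_0 = ∑ H_j` with orthogonal summands, `A_0 h A_0 = H_i h H_i` for `h ∈ H_i`. Writing `A_i`
and `A_{n-i}` as `A_0 A_i A_0` and `A_0 A_{n-i} A_0` puts `H_i` into `A_0 H_i A_0`. -/
theorem peirceH_le_sandwich [SetLike.GradedMul 𝒜] (hgrading : DirectSum.IsInternal 𝒜)
    (hsupport : ∀ k : ℤ, (n : ℤ) < |k| → 𝒜 k = ⊥)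
    (hzero : prod (prod (𝒜 0) ⊤) (𝒜 0) = ⊤) (hH : 𝒜 0 ≤ ⨆ i, peirceH n 𝒜 i)
    (i : Fin (n + 1)) : peirceH n 𝒜 i ≤ prod (prod (peirceH n 𝒜 i) ⊤) (peirceH n 𝒜 i) := by
  set T := prod (prod (peirceH n 𝒜 i) ⊤) (peirceH n 𝒜 i)
  have hT : ∀ b ∈ 𝒜 0, ∀ h ∈ peirceH n 𝒜 i, ∀ c ∈ 𝒜 0, b * h * c ∈ T := by
    intro b hb h hh c hc
    have h1 : ⨆ j, peirceH n 𝒜 j ≤ T.comap (LinearMap.mulRight Φ (h * c)) := by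
      refine iSup_le fun j k hk => ?_
      change k * (h * c) ∈ T
      by_cases hji : j = i
      · subst hji
        have h2 : ⨆ l, peirceH n 𝒜 l ≤ T.comap (LinearMap.mulLeft Φ (k * h)) := by
          refine iSup_le fun l m hm => ?_
          change k * h * m ∈ T
          by_cases hlj : j = l
          · subst hlj
            exact mul_mem_prod (mul_mem_prod hk Submodule.mem_top) hm
          · rw [mul_assoc, peirceH_mul_peirceH hsupport hlj hh hm, mul_zero]
            exact zero_mem _
        rw [← mul_assoc]
        exact h2 (hH hc)
      · rw [← mul_assoc, peirceH_mul_peirceH hsupport hji hk hh, zero_mul]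
        exact zero_mem _
    rw [mul_assoc]
    exact h1 (hH hb)
  refine peirceH_le fun x hx y hy z hz => ?_
  have hx' : prod (prod (𝒜 0) (𝒜 (i : ℕ))) (𝒜 0) ≤ T.comap (LinearMap.mulRight Φ (y * z)) := by
    refine prod_prod_le.2 fun b hb x hx c hc => ?_
    have hz' : prod (prod (𝒜 0) (𝒜 (n - (i : ℕ)))) (𝒜 0) ≤
        T.comap (LinearMap.mulLeft Φ (b * x * c * y)) := by
      refine prod_prod_le.2 fun b' hb' z hz c' hc' => ?_
      change b * x * c * y * (b' * z * c') ∈ T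
      rw [show b * x * c * y * (b' * z * c') = b * (x * (c * y * b') * z) * c' by
        simp only [mul_assoc]]
      exact hT b hb _ (mul_mem_prod (mul_mem_prod hx
        (mul_mul_mem_graded (by ring) hc hy hb')) hz) c' hc'
    change b * x * c * (y * z) ∈ T
    rw [← mul_assoc]
    exact hz' (le_zero_mul_mul_zero hgrading hzero _ hz)
  rw [mul_assoc]
  exact hx' (le_zero_mul_mul_zero hgrading hzero _ hx)

theorem peirceSystem_of_grading [SetLike.GradedMul 𝒜] (hgrading : DirectSum.IsInternal 𝒜)
    (hsupport : ∀ k : ℤ, (n : ℤ) < |k| → 𝒜 k = ⊥)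
    (hgen : idealSpan (Φ := Φ) (𝒜 (-n) : Set A) = ⊤)
    (hzero : prod (prod (𝒜 0) ⊤) (𝒜 0) = ⊤) :
    PeirceSystem (zeroComponent 𝒜) (peirceH n 𝒜) where
  le := peirceH_le_zero
  le_iSup := zero_le_iSup_peirceH hgrading hsupport (prod_prod_neg_eq_top hgen hzero)
  mul_eq_zero hij hx hy := peirceH_mul_peirceH hsupport hij hx hy
  corner {i x y} a hx hy := by
    have : ⨆ k, 𝒜 k ≤ (𝒜 0).comap ((LinearMap.mulRight Φ y).comp (LinearMap.mulLeft Φ x)) := by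
      refine iSup_le fun k a ha => ?_
      change x * a * y ∈ 𝒜 0
      by_cases hk : k = 0
      · subst hk
        exact mul_mul_mem_graded (by ring) (peirceH_le_zero i hx) ha (peirceH_le_zero i hy)
      -- With equal outer indices only the degree `0` part of the middle factor survives.
      · rw [peirceH_mul_mul_peirceH hsupport (by omega) hx ha hy]
        exact zero_mem _
    exact this (hgrading.submodule_iSup_eq_top.ge Submodule.mem_top)
  mul_mem_left hb hx := mul_mem_peirceH hb hx
  mul_mem_right hb hx := peirceH_mul_mem hb hx
  le_sandwich := peirceH_le_sandwich hgrading hsupport hzero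
    (zero_le_iSup_peirceH hgrading hsupport (prod_prod_neg_eq_top hgen hzero))
  full := hzero

/-- `A_k = A_0 A_k A_0` is the sum of the `H_i A_k H_j`. Those with `i - j ≠ k` vanish, and the
others are fixed by `e i` on the left and `e j` on the right. -/
theorem of_mem_idempotentGrading [IsSemiprime Φ A] [SetLike.GradedMul 𝒜]
    (hgrading : DirectSum.IsInternal 𝒜) (hsupport : ∀ k : ℤ, (n : ℤ) < |k| → 𝒜 k = ⊥)
    (hzero : prod (prod (𝒜 0) ⊤) (𝒜 0) = ⊤) (hH : 𝒜 0 ≤ ⨆ i, peirceH n 𝒜 i)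
    {e : Fin (n + 1) → Qs Φ A} (he : IsUnitFamily (peirceH n 𝒜) e) (k : ℤ) {a : A}
    (ha : a ∈ 𝒜 k) : Qs.of Φ A a ∈ idempotentGrading (Φ := Φ) e k := by
  let T := (idempotentGrading (Φ := Φ) e k).comap (Qs.of Φ A : A →ₗ[Φ] Qs Φ A)
  have key : prod (prod (𝒜 0) (𝒜 k)) (𝒜 0) ≤ T := by
    refine prod_prod_le.2 fun b hb x hx c hc => ?_
    have h1 : ⨆ i, peirceH n 𝒜 i ≤ T.comap (LinearMap.mulRight Φ (x * c)) := by
      refine iSup_le fun i h hh => ?_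
      have h2 : ⨆ j, peirceH n 𝒜 j ≤ T.comap (LinearMap.mulLeft Φ (h * x)) := by
        refine iSup_le fun j h' hh' => ?_
        change h * x * h' ∈ T
        by_cases hij : ((i : ℕ) : ℤ) - ((j : ℕ) : ℤ) = k
        · have h3 := sandwich_mem_idempotentGrading (Φ := Φ) (e := e) i j
            (Qs.of Φ A (h * x * h'))
          rw [map_mul, map_mul, ← mul_assoc, ← mul_assoc, (he i i h hh).2, mul_assoc,
            (he j j h' hh').1, if_pos rfl, if_pos rfl, ← map_mul, ← map_mul, hij] at h3
          exact h3
        · rw [peirceH_mul_mul_peirceH hsupport hij hh hx hh']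
          exact zero_mem _
      change h * (x * c) ∈ T
      rw [← mul_assoc]
      exact h2 (hH hc)
    rw [mul_assoc]
    exact h1 (hH hb)
  exact key (le_zero_mul_mul_zero hgrading hzero k ha)

end Gradings

end Martindale

theorem mainTheorem1 {Φ : Type*} {A : Type*} [CommRing Φ] [NonUnitalRing A] [Module Φ A]
    [IsScalarTower Φ A A] [SMulCommClass Φ A A] [Martindale.IsSemiprime Φ A]
    (n : ℕ) (𝒜 : ℤ → Submodule Φ A) [SetLike.GradedMul 𝒜]
    (hgrading : DirectSum.IsInternal 𝒜)
    (hsupport : ∀ k : ℤ, (n : ℤ) < |k| → 𝒜 k = ⊥)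
    (hfaithful : ∀ x : A, (∀ a : A, a * x = 0) → x = 0)
    (hgen : Martindale.idealSpan (Φ := Φ) (𝒜 (-n) : Set A) = ⊤)
    (hzero : Martindale.prod (Martindale.prod (𝒜 0) ⊤) (𝒜 0) = ⊤) :
    ∃ _ : Martindale.IsSemiprime Φ (Martindale.zeroComponent 𝒜),
      (∃ e : Fin (n + 1) → Martindale.Qs Φ A,
        CompleteOrthogonalIdempotents e ∧ Martindale.InducesGrading n 𝒜 e) ∧
      ∀ e : Fin (n + 1) → Martindale.Qs Φ A,
        CompleteOrthogonalIdempotents e → Martindale.InducesGrading n 𝒜 e →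
        ∃ _ : GradedAlgebra (Martindale.idempotentGrading (Φ := Φ) e),
          (∀ (k : ℤ) (a : A), a ∈ 𝒜 k →
            Martindale.Qs.of Φ A a ∈ Martindale.idempotentGrading (Φ := Φ) e k) ∧
          ∃ φ : Martindale.idempotentGrading (Φ := Φ) e 0 ≃ₐ[Φ]
              Martindale.Qs Φ (Martindale.zeroComponent 𝒜),
            ∀ (a : Martindale.zeroComponent 𝒜)
              (ha : Martindale.Qs.of Φ A (a : A) ∈ Martindale.idempotentGrading (Φ := Φ) e 0),
              φ ⟨Martindale.Qs.of Φ A (a : A), ha⟩ =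
                Martindale.Qs.of Φ (Martindale.zeroComponent 𝒜) a := by
  open Martindale in
  have P := peirceSystem_of_grading hgrading hsupport hgen hzero
  have hB : IsSemiprime Φ (zeroComponent 𝒜) := P.isSemiprime
  refine ⟨hB, ?_, fun e hc hind => ?_⟩
  · obtain ⟨e, he⟩ := P.exists_isUnitFamily
    exact ⟨e, P.completeOrthogonalIdempotents he, P.map_sandwich he⟩
  · have he : IsUnitFamily (peirceH n 𝒜) e := P.isUnitFamily hc.toOrthogonalIdempotents hind
    have hmem : ∀ k, ∀ a ∈ 𝒜 k, Qs.of Φ A a ∈ idempotentGrading (Φ := Φ) e k := fun k a ha =>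
      of_mem_idempotentGrading hgrading hsupport hzero P.le_iSup he k ha
    let := idempotentGradedAlgebra (Φ := Φ) hc
    refine ⟨idempotentGradedAlgebra hc, hmem, ?_⟩
    let j : idempotentGrading (Φ := Φ) e 0 →ₐ[Φ] Qs Φ A :=
      { toFun := Subtype.val
        map_one' := rfl
        map_mul' := fun _ _ => rfl
        map_zero' := rfl
        map_add' := fun _ _ => rfl
        commutes' := fun _ => rfl }
    let ι : zeroComponent 𝒜 →ₙₐ[Φ] idempotentGrading (Φ := Φ) e 0 :=
      { toFun := fun b => ⟨Qs.of Φ A b, hmem 0 b b.2⟩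
        map_smul' := fun c b => Subtype.ext (map_smul (Qs.of Φ A) c (b : A))
        map_zero' := Subtype.ext (map_zero (Qs.of Φ A))
        map_add' := fun b c => Subtype.ext (map_add (Qs.of Φ A) (b : A) c)
        map_mul' := fun b c => Subtype.ext (map_mul (Qs.of Φ A) (b : A) c) }
    -- The degree `0` component is exactly the fixed space of `s ↦ ∑ e i * s * e i`, so the
    -- characterization applies to it.
    have hQ : IsSymmetricQuotient Φ (zeroComponent 𝒜) _ ι :=
      P.isSymmetricQuotient he ι j Subtype.val_injective
        (fun s => by
          rw [← mem_idempotentGrading_zero (Φ := Φ) hc]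
          exact ⟨fun ⟨q, hq⟩ => hq ▸ q.2, fun hs => ⟨⟨s, hs⟩, rfl⟩⟩)
        fun b => rfl
    obtain ⟨φ, hφ⟩ := hQ.exists_algEquiv
    exact ⟨φ, fun a _ => hφ a⟩
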